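/- Let $p\ge 1$ and let $\alpha_1,\dots,\alpha_p>-1$ be real numbers with $\alpha_i-\alpha_j\notin\mathbb Z$ for $i\ne j$. For $\vec n=(n_1,\dots,n_p)\in\mathbb N_0^p$ put $|\vec n|=n_1+\cdots+n_p$; let $(x)_m=x(x+1)\cdots(x+m-1)$, $(x)_0=1$, and let $\vec e_k$ be the $k$-th unit vector. For a permutation $\pi$ of $\{1,\dots,p\}$ put $\vec s_0=\vec 0$, $\vec s_j=\sum_{i=1}^j\vec e_{\pi(i)}$ and $S(\pi,j)=\{i: j\le\pi^{-1}(i)\}$. **Multiple Laguerre polynomials of the first kind.** Define $L^{(i)}_{\vec n}=0$ if $n_i=0$ and otherwise $$L^{(i)}_{\vec n}(x)=\frac{(-1)^{|\vec n|-1}}{(n_i-1)!\,\prod_{q\ne i}(\alpha_q-\alpha_i)_{n_q}\,\Gamma(\alpha_i+1)}\sum_{l=0}^{n_i-1}\frac{(-n_i+1)_l}{l!\,(\alpha_i+1)_l}\prod_{q\neq i}\frac{(\alpha_i-\alpha_q-n_q+1)_l}{(\alpha_i-\alpha_q+1)_l}\,x^l ,$$ $$L_{\vec n}(x)=\sum_{l_1=0}^{n_1}\cdots\sum_{l_p=0}^{n_p}(-1)^{|\vec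 n|}\prod_{q=1}^p\frac{(\alpha_q+1)_{n_q}(-n_q)_{l_q}}{l_q!}\;\frac{\prod_{q=1}^{p-1}(\alpha_q+n_q+1)_{l_{q+1}+\cdots+l_p}}{\prod_{q=1}^{p}(\alpha_q+1)_{l_q+\cdots+l_p}}\;x^{l_1+\cdots+l_p}.$$ **Theorem.** (a) These are the multiple orthogonal polynomials for the weights $e^{-x}x^{\alpha_i}$ on $[0,\infty)$: $L_{\vec n}$ is monic of degree $|\vec n|$ with $\int_0^\infty x^jL_{\vec n}(x)e^{-x}x^{\alpha_i}\,dx=0$ for $0\le j<n_i$, $1\le i\le p$; and $\deg L^{(i)}_{\vec n}\le n_i-1$ with $\sum_{i=1}^p\int_0^\infty x^jL^{(i)}_{\vec n}(x)e^{-x}x^{\alpha_i}\,dx$ equal to $0$ for $0\le j\le|\vec n|-2$ and to $1$ for $j=|\vec n|-1\ge0$ (all integrals converging absolutely). (b) Put $$b^0_{\vec n}(k)=(\alpha_k+n_k+1)\prod_{q=1}^p\frac{\alpha_k-\alpha_q+n_k+1}{\alpha_k-\alpha_q+n_k+1-n_q}+\sum_{i=1}^p\frac{\alpha_i+n_i}{\alpha_i-\alpha_k-n_k+n_i-1}\cdot\frac{\prod_{q=1}^p(\alpha_i-\alpha_q+n_i)}{\prod_{q\ne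 i}(\alpha_i-\alpha_q+n_i-n_q)},$$ $$b^j_{\vec n}=\sum_{i\in S(\pi,j)}\frac{(\alpha_i+n_i)\prod_{q=1}^p(\alpha_i-\alpha_q+n_i)}{\prod_{q\in S(\pi,j),\,q\ne i}(\alpha_i-\alpha_q+n_i-n_q)},\qquad 1\le j\le p .$$ Then for every permutation $\pi$ and every $k\in\{1,\dots,p\}$ the nearest-neighbour recurrences hold: $$xL_{\vec n}=L_{\vec n+\vec e_k}+b^0_{\vec n}(k)L_{\vec n}+\sum_{j=1}^pb^j_{\vec n}L_{\vec n-\vec s_j},$$ for every $\vec n\in\mathbb N_0^p$ whose zero entries come last along $\pi$ (if $n_{\pi(i)}=0$ and $j\ge i$ then $n_{\pi(j)}=0$; in particular whenever all $n_i\ge1$), where $L_{\vec n-\vec s_j}:=0$ if $\vec n-\vec s_j\notin\mathbb N_0^p$; and $$xL^{(i)}_{\vec n}=L^{(i)}_{\vec n-\vec e_k}+b^0_{\vec n-\vec e_k}(k)L^{(i)}_{\vec n}+\sum_{j=1}^pb^j_{\vec n+\vec s_{j-1}}L^{(i)}_{\vec n+\vec s_j},\qquad 1\le i\le p,$$ for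 every $\vec n\in\mathbb N_0^p$ with $n_k\ge1$. (c) These coefficients are limits of the Jacobi–Piñeiro ones. Let $P^{(i)}_{\vec n}(x)=0$ if $n_i=0$ and otherwise $$P^{(i)}_{\vec n}(x)=\frac{(-1)^{|\vec n|-1}\prod_{q=1}^p(\alpha_q+\beta+|\vec n|)_{n_q}}{(n_i-1)!\prod_{q\ne i}(\alpha_q-\alpha_i)_{n_q}}\,\frac{\Gamma(\alpha_i+\beta+|\vec n|)}{\Gamma(\beta+|\vec n|)\Gamma(\alpha_i+1)}\sum_{l=0}^{n_i-1}\frac{(-n_i+1)_l(\alpha_i+\beta+|\vec n|)_l}{l!\,(\alpha_i+1)_l}\prod_{q\ne i}\frac{(\alpha_i-\alpha_q-n_q+1)_l}{(\alpha_i-\alpha_q+1)_l}\,x^l,$$ $$P_{\vec n}(x)=\sum_{l_1=0}^{n_1}\cdots\sum_{l_p=0}^{n_p}(-1)^{|\vec n|}\prod_{q=1}^p\left[\frac{(\alpha_q+1)_{n_q}}{(\alpha_q+\beta+|\vec n|+1)_{n_q}}\frac{(-n_q)_{l_q}}{l_q!}\,\frac{(\alpha_q+\beta+N_q+1)_{T_q}\,(\alpha_q+n_q+1)_{T_{q+1}}}{(\alpha_q+1)_{T_q}\,(\alpha_q+\beta+N_q+1)_{T_{q+1}}}\right]x^{T_1},$$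 with $N_q=n_1+\cdots+n_q$, $T_q=l_q+\cdots+l_p$, $T_{p+1}=0$, be the Jacobi–Piñeiro polynomials (weights $x^{\alpha_i}(1-x)^\beta$ on $[0,1]$), whose nearest-neighbour recurrence coefficients are $$b^0_{\vec n}(k;\beta)=\int_0^1xP_{\vec n}(x)\sum_{i=1}^pP^{(i)}_{\vec n+\vec e_k}(x)\,x^{\alpha_i}(1-x)^\beta\,dx,\qquad b^j_{\vec n}(\beta)=\int_0^1xP_{\vec n}(x)\sum_{i=1}^pP^{(i)}_{\vec n-\vec s_{j-1}}(x)\,x^{\alpha_i}(1-x)^\beta\,dx .$$ Then $\lim_{\beta\to\infty}\beta\,b^0_{\vec n}(k;\beta)=b^0_{\vec n}(k)$ for all $\vec n,k$, and $\lim_{\beta\to\infty}\beta^{j+1}b^j_{\vec n}(\beta)=b^j_{\vec n}$ for all $\pi$, $1\le j\le p$ and $\vec n$ with $\vec n-\vec s_{j-1}\in\mathbb N_0^p$. -/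

import Mathlib

open MeasureTheory Filter Topology Polynomial

noncomputable section

namespace MultLaguerre

variable {p : ℕ}

/-- The Pochhammer symbol `(x)_m = x (x + 1) ⋯ (x + m - 1)`, with `(x)_0 = 1`. -/
def poch (x : ℝ) (m : ℕ) : ℝ := (ascPochhammer ℝ m).eval x

/-- The length `|n| = n_1 + ⋯ + n_p` of a multi-index. -/
def len (n : Fin p → ℕ) : ℕ := ∑ i, n i

/-! ### Multiple orthogonality on a set `Δ`, for weights `w_1, …, w_p` (densities included) -/

/-- `B` is the monic type II multiple orthogonal polynomial of multi-index `n`. -/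
structure IsTypeII (Δ : Set ℝ) (w : Fin p → ℝ → ℝ) (n : Fin p → ℕ) (B : ℝ[X]) : Prop where
  monic : B.Monic
  natDegree_eq : B.natDegree = len n
  integrable : ∀ (i : Fin p) (j : ℕ), IntegrableOn (fun x => x ^ j * B.eval x * w i x) Δ
  orthogonal : ∀ (i : Fin p) (j : ℕ), j < n i → ∫ x in Δ, x ^ j * B.eval x * w i x = 0

/-- `A = (A^(1), …, A^(p))` is the vector of type I multiple orthogonal polynomials of
multi-index `n`: `deg A^(i) ≤ n_i - 1` (so `A^(i) = 0` when `n_i = 0`), and the linear form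
is orthogonal to `x^j` for `j ≤ |n| - 2` and normalised at `j = |n| - 1`. -/
structure IsTypeI (Δ : Set ℝ) (w : Fin p → ℝ → ℝ) (n : Fin p → ℕ) (A : Fin p → ℝ[X]) :
    Prop where
  degree_lt : ∀ i, (A i).degree < (n i : WithBot ℕ)
  integrable : ∀ (i : Fin p) (j : ℕ), IntegrableOn (fun x => x ^ j * (A i).eval x * w i x) Δ
  orthogonal : ∀ j : ℕ, j + 1 < len n → ∑ i, ∫ x in Δ, x ^ j * (A i).eval x * w i x = 0
  normalized : ∀ j : ℕ, j + 1 = len n → ∑ i, ∫ x in Δ, x ^ j * (A i).eval x * w i x = 1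

/-! ### Nearest-neighbour recurrence relations -/

/-- `s_j = e_{π(1)} + ⋯ + e_{π(j)}` (positions are numbered from `0` in `Fin p`). -/
def shift (π : Equiv.Perm (Fin p)) (j : ℕ) : Fin p → ℕ :=
  ∑ i ∈ Finset.univ.filter (fun i : Fin p => (i : ℕ) < j), Pi.single (π i) 1

/-- `S(π, j) = {i : j ≤ π⁻¹(i)}`, where the 1-based position of `i` is `π.symm i + 1`. -/
def setS (π : Equiv.Perm (Fin p)) (j : ℕ) : Finset (Fin p) :=
  Finset.univ.filter (fun i => j ≤ (π.symm i : ℕ) + 1)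

/-- The recurrence
`x B_n = B_{n+e_k} + b^0_n(k) B_n + ∑_{j=1}^p b^j_n B_{n-s_j}`,
where `B_{n-s_j} = 0` if `n - s_j` has a negative entry. -/
def TypeIIRecurrence (B : (Fin p → ℕ) → ℝ[X]) (b0 : (Fin p → ℕ) → Fin p → ℝ)
    (b : Equiv.Perm (Fin p) → (Fin p → ℕ) → ℕ → ℝ)
    (π : Equiv.Perm (Fin p)) (n : Fin p → ℕ) (k : Fin p) : Prop :=
  open Classical in
  X * B n = B (n + Pi.single k 1) + C (b0 n k) * B n
    + ∑ j ∈ Finset.Icc 1 p,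
        if shift π j ≤ n then C (b π n j) * B (n - shift π j) else 0

/-- The recurrences
`x A^(i)_n = A^(i)_{n-e_k} + b^0_{n-e_k}(k) A^(i)_n + ∑_{j=1}^p b^j_{n+s_{j-1}} A^(i)_{n+s_j}`
for `i = 1, …, p` (to be used for `n_k ≥ 1`, so that `n - e_k` is a multi-index). -/
def TypeIRecurrence (A : (Fin p → ℕ) → Fin p → ℝ[X]) (b0 : (Fin p → ℕ) → Fin p → ℝ)
    (b : Equiv.Perm (Fin p) → (Fin p → ℕ) → ℕ → ℝ)
    (π : Equiv.Perm (Fin p)) (n : Fin p → ℕ) (k : Fin p) : Prop :=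
  ∀ i, X * A n i = A (n - Pi.single k 1) i + C (b0 (n - Pi.single k 1) k) * A n i
    + ∑ j ∈ Finset.Icc 1 p, C (b π (n + shift π (j - 1)) j) * A (n + shift π j) i

/-! ### Multiple Laguerre polynomials of the first kind -/

/-- The weights `e^{-x} x^{α_i}` (on `[0, ∞)`). -/
def lagWeight (α : Fin p → ℝ) (i : Fin p) (x : ℝ) : ℝ := Real.exp (-x) * x ^ α i

/-- The coefficients `C_n^{l_1, …, l_p}` of the type II Laguerre polynomials. In the last product,
the factor of index `q` is `(α_q + n_q + 1)_{l_{q+1}+⋯+l_p} / (α_q + 1)_{l_q+⋯+l_p}`. -/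
def lagCoeffII (α : Fin p → ℝ) (n l : Fin p → ℕ) : ℝ :=
  (-1) ^ len n
    * (∏ q, poch (α q + 1) (n q) * (poch (-(n q : ℝ)) (l q) / (l q).factorial))
    * ∏ q, poch (α q + n q + 1) (∑ r ∈ Finset.Ioi q, l r)
        / poch (α q + 1) (∑ r ∈ Finset.Ici q, l r)

/-- The monic type II Laguerre polynomial `L_n`. -/
def lagII (α : Fin p → ℝ) (n : Fin p → ℕ) : ℝ[X] :=
  ∑ l ∈ Fintype.piFinset (fun q => Finset.range (n q + 1)),
    C (lagCoeffII α n l) * X ^ (∑ q, l q)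

/-- The type I Laguerre polynomials `L^(i)_n` (zero when `n_i = 0`). -/
def lagI (α : Fin p → ℝ) (n : Fin p → ℕ) (i : Fin p) : ℝ[X] :=
  C ((-1) ^ (len n - 1)
      / ((n i - 1).factorial * (∏ q ∈ Finset.univ.erase i, poch (α q - α i) (n q))
          * Real.Gamma (α i + 1)))
    * ∑ l ∈ Finset.range (n i),
        C (poch (-(n i : ℝ) + 1) l / l.factorial * (1 / poch (α i + 1) l)
            * ∏ q ∈ Finset.univ.erase i,
                poch (α i - α q - n q + 1) l / poch (α i - α q + 1) l) * X ^ l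

/-- The explicit coefficient `b^0_n(k)`. -/
def lagB0 (α : Fin p → ℝ) (n : Fin p → ℕ) (k : Fin p) : ℝ :=
  (α k + n k + 1) * ∏ q, (α k - α q + n k + 1) / (α k - α q + n k + 1 - n q)
    + ∑ i, (α i + n i) / (α i - α k - n k + n i - 1)
        * ((∏ q, (α i - α q + n i)) / ∏ q ∈ Finset.univ.erase i, (α i - α q + n i - n q))

/-- The explicit coefficient `b^j_n`, `1 ≤ j ≤ p`, attached to the permutation `π`. -/
def lagB (α : Fin p → ℝ) (π : Equiv.Perm (Fin p)) (n : Fin p → ℕ) (j : ℕ) : ℝ :=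
  ∑ i ∈ setS π j, ((α i + n i) * ∏ q, (α i - α q + n i))
    / ∏ q ∈ (setS π j).erase i, (α i - α q + n i - n q)

/-! ### Jacobi–Piñeiro polynomials and their recurrence coefficients -/

/-- The weights `x^{α_i} (1-x)^β` (on `[0, 1]`). -/
def jpWeight (α : Fin p → ℝ) (β : ℝ) (i : Fin p) (x : ℝ) : ℝ := x ^ α i * (1 - x) ^ β

/-- The coefficients `C_n^{l_1, …, l_p}` of the type II Jacobi–Piñeiro polynomials. -/
def jpCoeffII (α : Fin p → ℝ) (β : ℝ) (n l : Fin p → ℕ) : ℝ :=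
  (-1) ^ len n
    * (∏ q, poch (α q + 1) (n q) / poch (α q + β + len n + 1) (n q)
        * (poch (-(n q : ℝ)) (l q) / (l q).factorial))
    * ∏ q, (poch (α q + β + (∑ r ∈ Finset.Iic q, n r : ℕ) + 1) (∑ r ∈ Finset.Ici q, l r)
              / poch (α q + 1) (∑ r ∈ Finset.Ici q, l r))
          * (poch (α q + n q + 1) (∑ r ∈ Finset.Ioi q, l r)
              / poch (α q + β + (∑ r ∈ Finset.Iic q, n r : ℕ) + 1) (∑ r ∈ Finset.Ioi q, l r))

/-- The monic type II Jacobi–Piñeiro polynomial `P_n`. -/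
def jpII (α : Fin p → ℝ) (β : ℝ) (n : Fin p → ℕ) : ℝ[X] :=
  ∑ l ∈ Fintype.piFinset (fun q => Finset.range (n q + 1)),
    C (jpCoeffII α β n l) * X ^ (∑ q, l q)

/-- The type I Jacobi–Piñeiro polynomials `P^(i)_n` (zero when `n_i = 0`). -/
def jpI (α : Fin p → ℝ) (β : ℝ) (n : Fin p → ℕ) (i : Fin p) : ℝ[X] :=
  C ((-1) ^ (len n - 1)
      * ((∏ q, poch (α q + β + len n) (n q))
          / ((n i - 1).factorial * ∏ q ∈ Finset.univ.erase i, poch (α q - α i) (n q)))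
      * (Real.Gamma (α i + β + len n) / (Real.Gamma (β + len n) * Real.Gamma (α i + 1))))
    * ∑ l ∈ Finset.range (n i),
        C (poch (-(n i : ℝ) + 1) l * poch (α i + β + len n) l / (l.factorial * poch (α i + 1) l)
            * ∏ q ∈ Finset.univ.erase i,
                poch (α i - α q - n q + 1) l / poch (α i - α q + 1) l) * X ^ l

/-- The Jacobi–Piñeiro recurrence coefficient
`b^0_n(k) = ∫ x P_n (∑_i P^(i)_{n+e_k} w_i) dx`. -/
def jpB0 (α : Fin p → ℝ) (β : ℝ) (n : Fin p → ℕ) (k : Fin p) : ℝ :=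
  ∫ x in Set.Icc (0 : ℝ) 1, x * (jpII α β n).eval x
    * ∑ i, (jpI α β (n + Pi.single k 1) i).eval x * jpWeight α β i x

/-- The Jacobi–Piñeiro recurrence coefficient
`b^j_n = ∫ x P_n (∑_i P^(i)_{n-s_{j-1}} w_i) dx`, for `1 ≤ j ≤ p` and `s_{j-1} ≤ n`. -/
def jpB (α : Fin p → ℝ) (β : ℝ) (π : Equiv.Perm (Fin p)) (n : Fin p → ℕ) (j : ℕ) : ℝ :=
  ∫ x in Set.Icc (0 : ℝ) 1, x * (jpII α β n).eval x
    * ∑ i, (jpI α β (n - shift π (j - 1)) i).eval x * jpWeight α β i x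

end MultLaguerre

end

noncomputable section

namespace MultLaguerre

variable {p : ℕ}

/-! ### Pochhammer symbols -/

/-! The Mellin transform reduces everything to one rational function. Put `ω_n(u) = ∏_q ∏_{m<n_q} (u
- α_q - m)`. Iterated Chu–Vandermonde sums give `∫ L_n e^{-x} x^{s-1} dx = Γ(s) ω_n(s-1)`
(`mellin_lagII_eval`), so orthogonality is the vanishing of `ω_n` at its nodes. Dually, the
coefficient of `x^l` in `L^(i)_n` is the residue of `1/ω_n` at `α_i + l` divided by `Γ(α_i+l+1)`
(`coeff_lagI`), and the type I conditions are Lagrange interpolation at the nodes.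

Multiplication by `x` shifts `s` by one, so both recurrences come from `u ω_n(u)/ω_n(u-1) = u ∏_q
(u-α_q)/(u-α_q-n_q)`. Its polynomial part is `u + |n|`. Its simple poles at `α_i+n_i`, each expanded
in Newton form along `π`, give the terms `b^j / ∏_{l≤j} (u - α_{π(l)} - n_{π(l)})`. The result is
`mul_eval_omega_eq`: multiplied by `ω_n(u-1)` it is the type II recurrence; divided by `ω_n(u)
ω_n(u-1)`, with residues taken, it is the type I recurrence.

For the limits, the Jacobi–Piñeiro integrals expand into finite sums of beta moments that converge
term by term, after scaling by one common power of `β`, to the pairing of `x L_n` with a type I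
Laguerre form (`tendsto_integral_jpII_mul_jpI`). That pairing equals `b^0` by recurrence and
biorthogonality (`pairing_X_mul_add_single`), and `b^j` by direct evaluation of residues
(`pairing_X_mul_of_add_shift`). -/

@[simp] lemma poch_zero (x : ℝ) : poch x 0 = 1 := by simp [poch]

lemma poch_succ (x : ℝ) (m : ℕ) : poch x (m + 1) = poch x m * (x + m) := by
  simp [poch, ascPochhammer_succ_eval]

lemma poch_eq_prod (x : ℝ) (m : ℕ) : poch x m = ∏ k ∈ Finset.range m, (x + k) := by
  induction m with
  | zero => simp
  | succ m ih => rw [poch_succ, Finset.prod_range_succ, ih]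

lemma poch_add (x : ℝ) (m k : ℕ) : poch x (m + k) = poch x m * poch (x + m) k := by
  simp_rw [poch_eq_prod, Finset.prod_range_add]
  congr 1
  refine Finset.prod_congr rfl fun i _ => ?_
  push_cast; ring

lemma poch_succ_left (x : ℝ) (m : ℕ) : poch x (m + 1) = x * poch (x + 1) m := by
  rw [add_comm, poch_add]
  simp [poch_eq_prod]

lemma poch_pos {x : ℝ} (hx : 0 < x) (m : ℕ) : 0 < poch x m := by
  rw [poch_eq_prod]
  exact Finset.prod_pos fun k _ => by positivity

lemma poch_ne_zero {x : ℝ} (hx : ∀ k : ℕ, x + k ≠ 0) (m : ℕ) : poch x m ≠ 0 := by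
  rw [poch_eq_prod]
  exact Finset.prod_ne_zero_iff.mpr fun k _ => hx k

lemma Gamma_add_nat {x : ℝ} (hx : 0 < x) (m : ℕ) :
    Real.Gamma (x + m) = Real.Gamma x * poch x m := by
  induction m with
  | zero => simp
  | succ m ih =>
    rw [poch_succ, ← mul_assoc, ← ih, Nat.cast_succ, ← add_assoc, Real.Gamma_add_one (by positivity),
      mul_comm]

lemma poch_neg_nat (n l : ℕ) :
    poch (-(n : ℝ)) l / l.factorial = (-1) ^ l * (n.choose l : ℝ) := by
  have h : poch (-(n : ℝ)) l = (-1) ^ l * (n.descFactorial l : ℝ) := by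
    induction l with
    | zero => simp
    | succ l ih =>
      rw [poch_succ, ih, Nat.descFactorial_succ, pow_succ]
      -- The factor `n - l` is a truncated subtraction; past `l = n` it is harmless because the
      -- falling factorial is already zero.
      rcases le_or_gt l n with hl | hl
      · push_cast [hl]; ring
      · simp [Nat.descFactorial_of_lt hl]
  rw [h, Nat.descFactorial_eq_factorial_mul_choose]
  have := Nat.cast_ne_zero (R := ℝ).mpr l.factorial_ne_zero
  push_cast
  field_simp

/-- The Chu–Vandermonde summation. -/
lemma sum_chu_vandermonde (n : ℕ) (x y : ℝ) (hy : ∀ k : ℕ, y + k ≠ 0) :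
    ∑ l ∈ Finset.range (n + 1), poch (-(n : ℝ)) l / l.factorial * (poch x l / poch y l)
      = poch (y - x) n / poch y n := by
  simp_rw [poch_neg_nat]
  induction n generalizing x y with
  | zero => simp
  | succ n ih =>
    have hy1 : ∀ k : ℕ, y + 1 + k ≠ 0 := fun k => by
      have := hy (k + 1); push_cast at this; rwa [add_assoc, add_comm 1]
    have hy0 : y ≠ 0 := by simpa using hy 0
    -- Pascal's rule. The second part has `x` and `y` both raised by one, so `y - x` is preserved
    -- and induction applies to both parts.
    have key : ∑ l ∈ Finset.range (n + 1 + 1),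
        (-1) ^ l * ((n + 1).choose l : ℝ) * (poch x l / poch y l)
        = ∑ l ∈ Finset.range (n + 1), (-1) ^ l * (n.choose l : ℝ) * (poch x l / poch y l)
          - x / y * ∑ l ∈ Finset.range (n + 1),
            (-1) ^ l * (n.choose l : ℝ) * (poch (x + 1) l / poch (y + 1) l) := by
      rw [Finset.sum_range_succ']
      simp_rw [Nat.choose_succ_succ]
      push_cast
      simp_rw [mul_add, add_mul, Finset.sum_add_distrib]
      have e1 : ∑ l ∈ Finset.range (n + 1), (-1) ^ l * (n.choose l : ℝ) * (poch x l / poch y l)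
          = ∑ l ∈ Finset.range (n + 1), (-1) ^ (l + 1) * (n.choose (l + 1) : ℝ)
              * (poch x (l + 1) / poch y (l + 1)) + 1 := by
        rw [Finset.sum_range_succ', Finset.sum_range_succ]
        simp
      have e2 : ∑ l ∈ Finset.range (n + 1), (-1) ^ (l + 1) * (n.choose l : ℝ)
              * (poch x (l + 1) / poch y (l + 1)) = - (x / y * ∑ l ∈ Finset.range (n + 1),
            (-1) ^ l * (n.choose l : ℝ) * (poch (x + 1) l / poch (y + 1) l)) := by
        rw [Finset.mul_sum, ← Finset.sum_neg_distrib]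
        refine Finset.sum_congr rfl fun l _ => ?_
        rw [poch_succ_left, poch_succ_left, mul_div_mul_comm]
        ring
      rw [e1, e2]
      simp
      ring
    rw [key, ih x y hy, ih (x + 1) (y + 1) hy1]
    have h1 := poch_ne_zero hy n
    have h2 := poch_ne_zero hy1 n
    have h3 := hy n
    have h4 : poch y n * (y + n) = y * poch (y + 1) n := by
      rw [← poch_succ, poch_succ_left]
    rw [poch_succ (y - x), poch_succ y, add_sub_add_right_eq_sub]
    have h5 : x / y * (poch (y - x) n / poch (y + 1) n) = x * poch (y - x) n / (poch y n * (y + n)) := by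
      rw [h4]; field_simp
    rw [h5]
    field_simp
    ring

/-! ### The Mellin transform on polynomials -/

/-- The linear map `X ^ k ↦ (X)_k`, for which
`∫ P(x) e^{-x} x^{s-1} dx = Γ(s) (mellin P)(s)`. -/
def mellin : ℝ[X] →ₗ[ℝ] ℝ[X] :=
  Polynomial.lsum fun k => (LinearMap.id (M := ℝ)).smulRight (ascPochhammer ℝ k)

lemma mellin_C_mul_X_pow (a : ℝ) (k : ℕ) : mellin (C a * X ^ k) = C a * ascPochhammer ℝ k := by
  rw [C_mul_X_pow_eq_monomial, mellin, lsum_apply, sum_monomial_index]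
  · simp [smul_eq_C_mul]
  · simp

lemma mellin_eval_C_mul_X_pow (a s : ℝ) (k : ℕ) :
    (mellin (C a * X ^ k)).eval s = a * poch s k := by
  rw [mellin_C_mul_X_pow, eval_C_mul, poch]

lemma mellin_eq_sum (P : ℝ[X]) : mellin P = P.sum fun k a => C a * ascPochhammer ℝ k := by
  simp [mellin, lsum_apply, smul_eq_C_mul]

/-- Since `(s)_{k+1} = s (s+1)_k`, multiplication by `x` becomes a unit shift of the variable. -/
lemma mellin_eval_X_mul (P : ℝ[X]) (s : ℝ) :
    (mellin (X * P)).eval s = s * (mellin P).eval (s + 1) := by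
  induction P using Polynomial.induction_on' with
  | add P Q hP hQ => rw [mul_add, map_add, eval_add, hP, hQ, map_add, eval_add, mul_add]
  | monomial k a =>
    rw [← C_mul_X_pow_eq_monomial, show X * (C a * X ^ k) = C a * X ^ (k + 1) by ring,
      mellin_eval_C_mul_X_pow, mellin_eval_C_mul_X_pow, poch_succ_left]
    ring

/-- Rising factorials are monic of each degree, so the transform is unitriangular: degree, leading
coefficient and injectivity all follow from this. -/
lemma coeff_mellin {P : ℝ[X]} {N : ℕ} (hP : P.natDegree ≤ N) : (mellin P).coeff N = P.coeff N := by
  rw [mellin_eq_sum, sum_over_range' _ (by simp) (N + 1) (by omega), finsetSum_coeff,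
    Finset.sum_range_succ, Finset.sum_eq_zero, zero_add, coeff_C_mul]
  · have := (monic_ascPochhammer ℝ N).coeff_natDegree
    rw [ascPochhammer_natDegree] at this
    rw [this, mul_one]
  · intro k hk
    rw [coeff_C_mul, coeff_eq_zero_of_natDegree_lt (p := ascPochhammer ℝ k), mul_zero]
    rw [ascPochhammer_natDegree]
    exact Finset.mem_range.mp hk

lemma natDegree_mellin_le (P : ℝ[X]) : (mellin P).natDegree ≤ P.natDegree := by
  rw [mellin_eq_sum]
  refine natDegree_sum_le_of_forall_le _ _ fun k hk => ?_
  refine (natDegree_C_mul_le _ _).trans ?_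
  rw [ascPochhammer_natDegree]
  exact le_natDegree_of_mem_supp k hk

lemma natDegree_mellin (P : ℝ[X]) : (mellin P).natDegree = P.natDegree := by
  refine le_antisymm (natDegree_mellin_le P) ?_
  rcases eq_or_ne P 0 with rfl | hP
  · simp
  · refine le_natDegree_of_ne_zero ?_
    rw [coeff_mellin le_rfl]
    simpa using hP

lemma mellin_injective : Function.Injective mellin := by
  rw [← LinearMap.ker_eq_bot, LinearMap.ker_eq_bot']
  intro P hP
  have := coeff_mellin (P := P) le_rfl
  rw [hP, coeff_zero, coeff_natDegree] at this
  exact leadingCoeff_eq_zero.mp this.symm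

/-- By linearity only monomials matter, and there it is the Gamma integral with `Γ(s+k) = Γ(s)
(s)_k`. -/
lemma integrableOn_pow_mul_weight {a : ℝ} (ha : -1 < a) (P : ℝ[X]) (j : ℕ) :
    IntegrableOn (fun x => x ^ j * P.eval x * (Real.exp (-x) * x ^ a)) (Set.Ici 0) ∧
    ∫ x in Set.Ici 0, x ^ j * P.eval x * (Real.exp (-x) * x ^ a)
      = Real.Gamma (a + j + 1) * (mellin P).eval (a + j + 1) := by
  induction P using Polynomial.induction_on' with
  | add P Q hP hQ =>
    have e : (fun x => x ^ j * (P + Q).eval x * (Real.exp (-x) * x ^ a)) =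
      (fun x => x ^ j * P.eval x * (Real.exp (-x) * x ^ a)
        + x ^ j * Q.eval x * (Real.exp (-x) * x ^ a)) := by
      ext x; rw [eval_add]; ring
    rw [e]
    refine ⟨hP.1.add hQ.1, ?_⟩
    rw [integral_add hP.1 hQ.1, hP.2, hQ.2, map_add, eval_add, mul_add]
  | monomial k c =>
    have hj : (0 : ℝ) ≤ j := j.cast_nonneg
    have hk : (0 : ℝ) ≤ k := k.cast_nonneg
    have e : Set.EqOn (fun x : ℝ => x ^ j * (monomial k c).eval x * (Real.exp (-x) * x ^ a))
        (fun x => c * (Real.exp (-x) * x ^ ((a + j + 1 + k) - 1))) (Set.Ioi 0) := by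
      intro x hx
      have hx : 0 < x := hx
      have : x ^ ((a + j + 1 + k) - 1) = x ^ a * x ^ j * x ^ k := by
        rw [show a + j + 1 + k - 1 = a + j + k by ring, Real.rpow_add hx, Real.rpow_add hx,
          Real.rpow_natCast, Real.rpow_natCast]
      simp only [eval_monomial, this]
      ring
    rw [integrableOn_Ici_iff_integrableOn_Ioi, integral_Ici_eq_integral_Ioi,
      integrableOn_congr_fun e measurableSet_Ioi, setIntegral_congr_fun measurableSet_Ioi e]
    refine ⟨(Real.GammaIntegral_convergent (by linarith)).const_mul c, ?_⟩
    rw [integral_const_mul, ← Real.Gamma_eq_integral (by linarith), Gamma_add_nat (by linarith),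
      ← C_mul_X_pow_eq_monomial, mellin_eval_C_mul_X_pow]
    ring

/-! ### The transform of the type II polynomials -/

lemma sum_Ici_zero (l : Fin (p + 1) → ℕ) : ∑ r ∈ Finset.Ici 0, l r = l 0 + ∑ r, l (Fin.succ r) := by
  rw [← Fin.sum_univ_succ]
  congr 1
  ext; simp

lemma sum_Ioi_zero (l : Fin (p + 1) → ℕ) : ∑ r ∈ Finset.Ioi 0, l r = ∑ r, l (Fin.succ r) := by
  rw [Fin.Ioi_zero_eq_map, Finset.sum_map]
  rfl

lemma sum_Ici_succ (l : Fin (p + 1) → ℕ) (q : Fin p) :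
    ∑ r ∈ Finset.Ici q.succ, l r = ∑ r ∈ Finset.Ici q, l (Fin.succ r) := by
  have h : ∀ {k : ℕ} (q : Fin k), Finset.Ici q = Finset.univ.filter (fun r => q ≤ r) := by
    intro k q; ext; simp
  rw [h, h, Finset.sum_filter, Finset.sum_filter, Fin.sum_univ_succ]
  simp

lemma sum_Ioi_succ (l : Fin (p + 1) → ℕ) (q : Fin p) :
    ∑ r ∈ Finset.Ioi q.succ, l r = ∑ r ∈ Finset.Ioi q, l (Fin.succ r) := by
  have h : ∀ {k : ℕ} (q : Fin k), Finset.Ioi q = Finset.univ.filter (fun r => q < r) := by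
    intro k q; ext; simp
  rw [h, h, Finset.sum_filter, Finset.sum_filter, Fin.sum_univ_succ]
  simp

/-- The first index is summed innermost, with the tail fixed, so that the inner sum is a single
Chu–Vandermonde sum. -/
lemma sum_piFinset_cons (s : Fin (p + 1) → Finset ℕ) (f : (Fin (p + 1) → ℕ) → ℝ) :
    ∑ l ∈ Fintype.piFinset s, f l
      = ∑ l ∈ Fintype.piFinset (fun q : Fin p => s q.succ), ∑ a ∈ s 0, f (Fin.cons a l) := by
  rw [← Finset.sum_product_right (f := fun x => f (Fin.cons x.1 x.2))]
  refine Finset.sum_nbij' (fun l => (l 0, Fin.tail l)) (fun x => Fin.cons x.1 x.2) ?_ ?_ ?_ ?_ ?_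
  · intro l hl
    rw [Fintype.mem_piFinset] at hl
    simpa [Fin.tail] using ⟨hl 0, fun q => hl q.succ⟩
  · rintro ⟨a, l⟩ hl
    simpa [Fin.forall_fin_succ] using hl
  · intro l _; simp
  · intro x _; simp
  · intro l _; simp

/-- With `T` the sum of the later indices, the `l_0`-sum is a Chu–Vandermonde sum with parameters `s
+ T` and `α_0 + 1 + T`. Their difference is free of `T`, and the remaining dependence on `T` cancels
against `(α_0+n_0+1)_T`, so a factor `(α_0+1-s)_{n_0}` comes out of the whole sum. -/
lemma sum_multiple_chu_vandermonde (α : Fin p → ℝ) (hα : ∀ i, -1 < α i) (n : Fin p → ℕ) (s : ℝ) :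
    ∑ l ∈ Fintype.piFinset (fun q => Finset.range (n q + 1)),
      (∏ q, poch (α q + 1) (n q) * (poch (-(n q : ℝ)) (l q) / (l q).factorial))
        * (∏ q, poch (α q + n q + 1) (∑ r ∈ Finset.Ioi q, l r)
          / poch (α q + 1) (∑ r ∈ Finset.Ici q, l r)) * poch s (∑ q, l q)
      = ∏ q, poch (α q + 1 - s) (n q) := by
  induction p with
  | zero => simp [Fintype.piFinset]
  | succ p ih =>
    rw [sum_piFinset_cons, Fin.prod_univ_succ, ← ih (fun q => α q.succ) (fun q => hα _)
      (fun q => n q.succ), Finset.mul_sum]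
    refine Finset.sum_congr rfl fun l _ => ?_
    have h0 : ∀ k : ℕ, α 0 + 1 + k ≠ 0 := fun k => by
      have := hα 0; have : (0 : ℝ) ≤ k := k.cast_nonneg; linarith
    set T := ∑ q, l q with hT
    have hT' : ∀ k : ℕ, α 0 + 1 + T + k ≠ 0 := fun k => by
      have := h0 (T + k); push_cast at this; rwa [← add_assoc] at this
    have cv := sum_chu_vandermonde (n 0) (s + T) (α 0 + 1 + T) hT'
    have n1 := poch_ne_zero hT' (n 0)
    have n2 := poch_ne_zero h0 T
    -- Both sides are `(α_0+1)_{n_0+T}`.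
    have e : poch (α 0 + 1) (n 0) * poch (α 0 + n 0 + 1) T
        = poch (α 0 + 1) T * poch (α 0 + 1 + T) (n 0) := by
      rw [← poch_add, show α 0 + n 0 + 1 = α 0 + 1 + n 0 by ring, ← poch_add, add_comm (n 0)]
    simp_rw [Fin.prod_univ_succ, sum_Ici_succ, sum_Ioi_succ, Fin.sum_univ_succ, sum_Ici_zero,
      sum_Ioi_zero, Fin.cons_zero, Fin.cons_succ]
    simp_rw [← hT, add_comm _ T, poch_add]
    rw [show α 0 + 1 + T - (s + T) = α 0 + 1 - s by ring] at cv
    set A := ∏ q : Fin p, poch (α q.succ + 1) (n q.succ)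
      * (poch (-(n q.succ : ℝ)) (l q) / (l q).factorial)
    set B := ∏ q : Fin p, poch (α q.succ + n q.succ + 1) (∑ r ∈ Finset.Ioi q, l r)
          / poch (α q.succ + 1) (∑ r ∈ Finset.Ici q, l r)
    have e2 : poch (α 0 + 1 - s) (n 0) = poch (α 0 + 1) (n 0) * poch (α 0 + n 0 + 1) T
        / poch (α 0 + 1) T * ∑ l ∈ Finset.range (n 0 + 1), poch (-(n 0 : ℝ)) l / l.factorial
          * (poch (s + T) l / poch (α 0 + 1 + T) l) := by
      rw [cv, e]; field_simp
    rw [e2, Finset.mul_sum, Finset.sum_mul]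
    refine Finset.sum_congr rfl fun a _ => ?_
    simp only [div_eq_mul_inv, mul_inv]
    ring

/-- The node `α_i + l`, indexed by the pair `⟨i, l⟩`. -/
def node (α : Fin p → ℝ) (x : Σ _ : Fin p, ℕ) : ℝ := α x.1 + x.2

/-- The indices `⟨i, l⟩`, `l < n_i`, of the nodes of the multi-index `n`. -/
def nodes (n : Fin p → ℕ) : Finset (Σ _ : Fin p, ℕ) :=
  Finset.univ.sigma fun q => Finset.range (n q)

@[simp] lemma mem_nodes {n : Fin p → ℕ} {x : Σ _ : Fin p, ℕ} : x ∈ nodes n ↔ x.2 < n x.1 := by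
  simp [nodes]

lemma card_nodes (n : Fin p → ℕ) : (nodes n).card = len n := by
  simp [nodes, len]

/-- The monic polynomial with zeros `α_q + m`, `m < n_q`. -/
def omega (α : Fin p → ℝ) (n : Fin p → ℕ) : ℝ[X] := Lagrange.nodal (nodes n) (node α)

lemma eval_omega (α : Fin p → ℝ) (n : Fin p → ℕ) (u : ℝ) :
    (omega α n).eval u = ∏ q, ∏ m ∈ Finset.range (n q), (u - α q - m) := by
  rw [omega, Lagrange.eval_nodal, nodes, Finset.prod_sigma]
  simp [node, sub_sub]

/-- The sign `(-1)^{|n|}` turns each `(α_q+1-s)_{n_q}` into `∏_m (s-1-α_q-m)`. -/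
lemma mellin_lagII_eval (α : Fin p → ℝ) (hα : ∀ i, -1 < α i) (n : Fin p → ℕ) (s : ℝ) :
    (mellin (lagII α n)).eval s = (omega α n).eval (s - 1) := by
  have h := sum_multiple_chu_vandermonde α hα n s
  rw [lagII, map_sum, eval_finsetSum]
  simp_rw [mellin_eval_C_mul_X_pow, lagCoeffII, mul_assoc, ← Finset.mul_sum]
  simp_rw [mul_assoc] at h
  rw [h, eval_omega, len, ← Finset.prod_pow_eq_pow_sum, ← Finset.prod_mul_distrib]
  refine Finset.prod_congr rfl fun q _ => ?_
  rw [poch_eq_prod]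
  nth_rw 1 [← Finset.card_range (n q)]
  rw [← Finset.prod_const, ← Finset.prod_mul_distrib]
  exact Finset.prod_congr rfl fun k _ => by ring

lemma mellin_lagII (α : Fin p → ℝ) (hα : ∀ i, -1 < α i) (n : Fin p → ℕ) :
    mellin (lagII α n) = (omega α n).comp (X - C 1) :=
  Polynomial.funext fun s => by simp [mellin_lagII_eval α hα n s]

/-- The `j`-th moment against the `i`-th weight is a Gamma value times `ω_n(α_i+j)`, and `α_i + j`
is a zero of `ω_n` for `j < n_i`. -/
lemma isTypeII_lagII (α : Fin p → ℝ) (hα : ∀ i, -1 < α i) (n : Fin p → ℕ) :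
    IsTypeII (Set.Ici 0) (lagWeight α) n (lagII α n) := by
  have hω : (omega α n).natDegree = len n := by
    rw [omega, Lagrange.natDegree_nodal, card_nodes]
  have hm : (mellin (lagII α n)).Monic := by
    rw [mellin_lagII α hα]
    exact Lagrange.nodal_monic.comp_X_sub_C 1
  have hd : (lagII α n).natDegree = len n := by
    rw [← natDegree_mellin, mellin_lagII α hα, natDegree_comp, natDegree_X_sub_C, hω, mul_one]
  refine ⟨?_, hd, fun i j => (integrableOn_pow_mul_weight (hα i) _ j).1, fun i j hj => ?_⟩
  · rw [Monic, leadingCoeff, ← coeff_mellin le_rfl, ← natDegree_mellin]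
    exact hm
  · simp only [lagWeight]
    rw [(integrableOn_pow_mul_weight (hα i) _ j).2, mellin_lagII_eval α hα, eval_omega,
      Finset.prod_eq_zero (Finset.mem_univ i), mul_zero]
    exact Finset.prod_eq_zero (Finset.mem_range.mpr hj) (by ring)

/-! ### The type I polynomials -/

/-- This is where non-integrality of the differences enters: all zeros of `ω_n` are simple. -/
lemma node_injective {α : Fin p → ℝ} (hdiff : ∀ i j, i ≠ j → ∀ z : ℤ, α i - α j ≠ z) :
    Function.Injective (node α) := by
  rintro ⟨i, l⟩ ⟨j, m⟩ h
  simp only [node] at h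
  rcases eq_or_ne i j with rfl | hij
  · simpa using h
  · exact absurd (by push_cast; linarith) (hdiff i j hij ((m : ℤ) - l))

lemma prod_erase_range_sub (l k : ℕ) :
    ∏ m ∈ (Finset.range (l + 1 + k)).erase l, ((l : ℝ) - m)
      = (-1) ^ k * (l.factorial * k.factorial) := by
  induction k with
  | zero =>
    rw [add_zero, Finset.range_add_one, Finset.erase_insert (by simp)]
    have : ∀ n : ℕ, ∏ m ∈ Finset.range n, ((n : ℝ) - m) = n.factorial := by
      intro n
      induction n with
      | zero => simp
      | succ n ih =>
        rw [Finset.prod_range_succ', Nat.factorial_succ]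
        push_cast
        simp_rw [add_sub_add_right_eq_sub, ih]
        ring
    simp [this]
  | succ k ih =>
    rw [← add_assoc, Finset.range_add_one, Finset.erase_insert_of_ne (by omega),
      Finset.prod_insert (by simp), ih, Nat.factorial_succ]
    push_cast
    ring

/-- Used with `x = α_i - α_q`: it converts the contribution of block `q` to a residue into the
Pochhammer ratio of the explicit formula. -/
lemma prod_range_add_sub (x : ℝ) (hx : ∀ z : ℤ, x ≠ z) (n l : ℕ) :
    (∏ m ∈ Finset.range n, (x + l - m))⁻¹
      = (-1) ^ n * (poch (-x) n)⁻¹ * (poch (x - n + 1) l / poch (x + 1) l) := by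
  have key : ∀ y : ℝ, ∏ m ∈ Finset.range n, (y - m) = poch (y - n + 1) n := by
    intro y
    rw [poch_eq_prod, ← Finset.prod_range_reflect]
    refine Finset.prod_congr rfl fun m hm => ?_
    have : m + 1 ≤ n := Finset.mem_range.mp hm
    rw [Nat.sub_sub, add_comm 1 m, Nat.cast_sub this]
    push_cast; ring
  have h1 : (-1) ^ n * poch (-x) n = poch (x - n + 1) n := by
    rw [← key, poch_eq_prod]
    nth_rw 1 [← Finset.card_range n]
    rw [← Finset.prod_const, ← Finset.prod_mul_distrib]
    exact Finset.prod_congr rfl fun k _ => by ring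
  -- Both sides are `(x-n+1)_{n+l}`.
  have h2 : poch (x - n + 1) n * poch (x + 1) l = poch (x - n + 1) l * poch (x + l - n + 1) n := by
    rw [show x + 1 = x - n + 1 + n by ring, ← poch_add,
      show x + l - n + 1 = x - n + 1 + l by ring, ← poch_add, add_comm n]
  have nz : ∀ (z : ℤ) (m : ℕ), poch (x + z) m ≠ 0 := fun z m => poch_ne_zero (fun k h =>
    hx (-z - k) (by push_cast; linarith)) m
  have n1 : poch (x + l - n + 1) n ≠ 0 := by
    have := nz (l - n + 1) n; push_cast at this; rwa [← add_assoc, ← add_sub_assoc] at this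
  have n2 : poch (x + 1) l ≠ 0 := by have := nz 1 l; push_cast at this; exact this
  have n3 : poch (x - n + 1) n ≠ 0 := by
    have := nz (-n + 1) n; push_cast at this; rwa [← add_assoc, ← sub_eq_add_neg] at this
  have n4 : poch (-x) n ≠ 0 := fun h => n3 (by rw [← h1, h, mul_zero])
  rw [key, inv_eq_iff_eq_inv]
  have h3 : (poch (x - n + 1) l) ≠ 0 := by
    intro h; rw [h, zero_mul] at h2; exact (mul_ne_zero n3 n2) h2
  have h4 : ((-1 : ℝ) ^ n * (poch (-x) n)⁻¹)⁻¹ = poch (x - n + 1) n := by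
    rw [← h1, mul_inv, inv_inv, ← inv_pow]; norm_num
  rw [mul_inv, h4, inv_div]
  field_simp
  linarith

/-- The residue at `α_i + l` of the reciprocal of `omega α n`. -/
def residue (α : Fin p → ℝ) (n : Fin p → ℕ) (i : Fin p) (l : ℕ) : ℝ :=
  if l < n i then Lagrange.nodalWeight (nodes n) (node α) ⟨i, l⟩ else 0

lemma nodalWeight_nodes (α : Fin p → ℝ) (n : Fin p → ℕ) (i : Fin p) (l : ℕ) :
    Lagrange.nodalWeight (nodes n) (node α) ⟨i, l⟩
      = (∏ m ∈ (Finset.range (n i)).erase l, ((l : ℝ) - m))⁻¹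
        * ∏ q ∈ Finset.univ.erase i, (∏ m ∈ Finset.range (n q), (α i - α q + l - m))⁻¹ := by
  have e : (nodes n).erase ⟨i, l⟩ = Finset.univ.sigma
      (fun q => if q = i then (Finset.range (n q)).erase l else Finset.range (n q)) := by
    ext ⟨q, m⟩
    simp only [Finset.mem_erase, mem_nodes, Finset.mem_sigma, Finset.mem_univ, true_and]
    by_cases h : q = i
    · subst h; simp
    · simp [h]
  rw [Lagrange.nodalWeight, e, Finset.prod_sigma, ← Finset.mul_prod_erase _ _ (Finset.mem_univ i),
    if_pos rfl, ← Finset.prod_inv_distrib]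
  congr 1
  · refine Finset.prod_congr rfl fun m _ => ?_
    simp [node]
  · refine Finset.prod_congr rfl fun q hq => ?_
    rw [if_neg (Finset.ne_of_mem_erase hq), ← Finset.prod_inv_distrib]
    refine Finset.prod_congr rfl fun m _ => ?_
    congr 1
    simp only [node]; ring

/-- In the residue of `1/ω_n` at `α_i + l`, the nodes of block `i` give the factorials and the other
blocks give the Pochhammer ratios. The explicit hypergeometric formula is used only here and in the
limit `β → ∞`. -/
lemma coeff_lagI {α : Fin p → ℝ} (hα : ∀ i, -1 < α i)
    (hdiff : ∀ i j, i ≠ j → ∀ z : ℤ, α i - α j ≠ z) (n : Fin p → ℕ) (i : Fin p) (l : ℕ) :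
    (lagI α n i).coeff l = residue α n i l / Real.Gamma (α i + l + 1) := by
  rw [lagI, coeff_C_mul, finsetSum_coeff]
  simp_rw [coeff_C_mul, coeff_X_pow, mul_ite, mul_one, mul_zero]
  rw [Finset.sum_ite_eq, residue]
  by_cases hl : l < n i
  swap
  · simp [hl]
  rw [if_pos (Finset.mem_range.mpr hl), if_pos hl, nodalWeight_nodes]
  -- `k` counts the nodes of block `i` above `α_i + l`; then `n_i - 1 = l + k` and no truncated
  -- subtraction remains.
  obtain ⟨k, hk⟩ : ∃ k, n i = l + 1 + k := ⟨n i - (l + 1), by omega⟩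
  have e1 : ∏ q ∈ Finset.univ.erase i, (∏ m ∈ Finset.range (n q), (α i - α q + l - m))⁻¹
      = (∏ q ∈ Finset.univ.erase i, (-1) ^ n q) * (∏ q ∈ Finset.univ.erase i,
          poch (α q - α i) (n q))⁻¹ * ∏ q ∈ Finset.univ.erase i,
          poch (α i - α q - n q + 1) l / poch (α i - α q + 1) l := by
    rw [← Finset.prod_inv_distrib, ← Finset.prod_mul_distrib, ← Finset.prod_mul_distrib]
    refine Finset.prod_congr rfl fun q hq => ?_
    rw [prod_range_add_sub _ (hdiff _ _ (Finset.ne_of_mem_erase hq).symm), neg_sub]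
  have e2 : ((-1 : ℝ)) ^ (len n - 1)
      = (-1) ^ (l + k) * ∏ q ∈ Finset.univ.erase i, (-1) ^ n q := by
    rw [Finset.prod_pow_eq_pow_sum, ← pow_add]
    congr 1
    rw [len, ← Finset.add_sum_erase _ _ (Finset.mem_univ i), hk]
    omega
  have e3 : poch (-(n i : ℝ) + 1) l / l.factorial = (-1) ^ l * ((l + k).choose l : ℝ) := by
    rw [← poch_neg_nat, hk]; push_cast; ring_nf
  have e4 : ((l + k).choose l : ℝ) * l.factorial * k.factorial = ((l + k).factorial : ℝ) := by
    rw [Nat.choose_symm_add]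
    exact_mod_cast Nat.add_choose_mul_factorial_mul_factorial l k
  have hi := hα i
  have e5 : Real.Gamma (α i + l + 1) = Real.Gamma (α i + 1) * poch (α i + 1) l := by
    rw [← Gamma_add_nat (by linarith)]; ring_nf
  have e6 : ((-1 : ℝ) ^ l) * (-1) ^ l = 1 := by rw [← mul_pow]; norm_num
  have e7 : ((-1 : ℝ) ^ k)⁻¹ = (-1) ^ k := by rw [← inv_pow]; norm_num
  have f1 : (l.factorial : ℝ) ≠ 0 := Nat.cast_ne_zero.mpr l.factorial_ne_zero
  have f2 : (k.factorial : ℝ) ≠ 0 := Nat.cast_ne_zero.mpr k.factorial_ne_zero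
  have f3 : ((l + k).factorial : ℝ) ≠ 0 := Nat.cast_ne_zero.mpr (l + k).factorial_ne_zero
  have f4 : ((l + k).choose l : ℝ) / (l + k).factorial = (l.factorial * k.factorial : ℝ)⁻¹ := by
    rw [div_eq_iff f3, ← e4]; field_simp
  rw [e1, e2, e3, e5, hk, prod_erase_range_sub, show l + 1 + k - 1 = l + k by omega]
  set E := ∏ q ∈ Finset.univ.erase i, (-1 : ℝ) ^ n q
  set F := ∏ q ∈ Finset.univ.erase i, poch (α q - α i) (n q)
  set G := ∏ q ∈ Finset.univ.erase i, poch (α i - α q - n q + 1) l / poch (α i - α q + 1) l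
  calc _ = ((-1) ^ l * (-1) ^ l) * (-1) ^ k * (((l + k).choose l : ℝ) / (l + k).factorial) * E * F⁻¹
        * G * ((Real.Gamma (α i + 1))⁻¹ * (poch (α i + 1) l)⁻¹) := by
          rw [pow_add]; simp only [div_eq_mul_inv, mul_inv]; ring
    _ = _ := by
          rw [e6, f4]; simp only [div_eq_mul_inv, mul_inv, e7]; ring

lemma degree_lagI_lt {α : Fin p → ℝ} (hα : ∀ i, -1 < α i)
    (hdiff : ∀ i j, i ≠ j → ∀ z : ℤ, α i - α j ≠ z) (n : Fin p → ℕ) (i : Fin p) :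
    (lagI α n i).degree < (n i : WithBot ℕ) := by
  rw [degree_lt_iff_coeff_zero]
  intro l hl
  rw [coeff_lagI hα hdiff, residue, if_neg (by omega), zero_div]

lemma lagI_eq_sum {α : Fin p → ℝ} (hα : ∀ i, -1 < α i)
    (hdiff : ∀ i j, i ≠ j → ∀ z : ℤ, α i - α j ≠ z) (n : Fin p → ℕ) (i : Fin p) :
    lagI α n i = ∑ l ∈ Finset.range (n i),
      C (Lagrange.nodalWeight (nodes n) (node α) ⟨i, l⟩ / Real.Gamma (α i + l + 1)) * X ^ l := by
  ext l
  rw [coeff_lagI hα hdiff, finsetSum_coeff]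
  simp_rw [coeff_C_mul, coeff_X_pow, mul_ite, mul_one, mul_zero]
  rw [Finset.sum_ite_eq, residue]
  simp [ite_div]

/-- Lagrange interpolation at the zeros of `ω_n` reproduces `P`; comparing top coefficients gives
the sum of the residues of `P/ω_n`. -/
lemma sum_nodalWeight_mul_eval {α : Fin p → ℝ}
    (hdiff : ∀ i j, i ≠ j → ∀ z : ℤ, α i - α j ≠ z) (n : Fin p → ℕ) {P : ℝ[X]}
    (hP : P.degree < (len n : WithBot ℕ)) :
    ∑ x ∈ nodes n, Lagrange.nodalWeight (nodes n) (node α) x * P.eval (node α x)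
      = P.coeff (len n - 1) := by
  rw [← card_nodes] at hP ⊢
  rw [Lagrange.coeff_eq_sum (node_injective hdiff).injOn hP]
  refine Finset.sum_congr rfl fun x _ => ?_
  rw [Lagrange.nodalWeight, Finset.prod_inv_distrib]
  ring

/-- The `j`-th moment of the linear form is the sum over the nodes of the residues of `1/ω_n` times
`(u+1)_j`, a monic polynomial of degree `j`; its coefficient at `|n| - 1` is `0` or `1`. -/
lemma isTypeI_lagI {α : Fin p → ℝ} (hα : ∀ i, -1 < α i)
    (hdiff : ∀ i j, i ≠ j → ∀ z : ℤ, α i - α j ≠ z) (n : Fin p → ℕ) :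
    IsTypeI (Set.Ici 0) (lagWeight α) n (lagI α n) := by
  have key : ∀ j : ℕ, j < len n →
      ∑ i, ∫ x in Set.Ici 0, x ^ j * (lagI α n i).eval x * lagWeight α i x
        = if j + 1 = len n then 1 else 0 := by
    intro j hj
    have hd : ((ascPochhammer ℝ j).comp (X + C 1)).natDegree = j := by
      rw [natDegree_comp, ascPochhammer_natDegree, natDegree_X_add_C, mul_one]
    have hm : ((ascPochhammer ℝ j).comp (X + C 1)).Monic := (monic_ascPochhammer ℝ j).comp_X_add_C 1
    have := sum_nodalWeight_mul_eval hdiff n (P := (ascPochhammer ℝ j).comp (X + C 1)) (by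
      rw [degree_eq_natDegree hm.ne_zero, hd]; exact_mod_cast hj)
    have hc : ((ascPochhammer ℝ j).comp (X + C 1)).coeff (len n - 1)
        = if j + 1 = len n then 1 else 0 := by
      split_ifs with h
      · rw [← h, Nat.add_sub_cancel]
        nth_rw 2 [← hd]
        exact hm.coeff_natDegree
      · exact coeff_eq_zero_of_natDegree_lt (by rw [hd]; omega)
    rw [← hc, ← this, nodes, Finset.sum_sigma]
    refine Finset.sum_congr rfl fun i _ => ?_
    have hi := hα i
    simp only [lagWeight]
    rw [(integrableOn_pow_mul_weight (hα i) _ j).2, lagI_eq_sum hα hdiff, map_sum, eval_finsetSum,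
      Finset.mul_sum]
    refine Finset.sum_congr rfl fun l _ => ?_
    have hj0 : (0 : ℝ) ≤ j := j.cast_nonneg
    have hl0 : (0 : ℝ) ≤ l := l.cast_nonneg
    have g : Real.Gamma (α i + l + 1) ≠ 0 := (Real.Gamma_pos_of_pos (by linarith)).ne'
    -- Both sides are `Γ(α_i+j+l+1)`; this symmetry trades the power `l` of the form for the moment
    -- index `j`.
    have e : Real.Gamma (α i + j + 1) * poch (α i + j + 1) l
        = Real.Gamma (α i + l + 1) * poch (α i + l + 1) j := by
      rw [← Gamma_add_nat (by linarith), ← Gamma_add_nat (by linarith)]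
      ring_nf
    rw [mellin_eval_C_mul_X_pow, mul_left_comm, e]
    simp only [node, eval_comp, eval_add, eval_X, eval_C]
    rw [← poch, nodes]
    field_simp
  refine ⟨degree_lagI_lt hα hdiff n, fun i j => (integrableOn_pow_mul_weight (hα i) _ j).1,
    fun j hj => ?_, fun j hj => ?_⟩
  · rw [key j (by omega), if_neg (by omega)]
  · rw [key j (by omega), if_pos hj]

/-! ### Partial fractions and Newton form -/

lemma shift_apply (π : Equiv.Perm (Fin p)) (j : ℕ) (q : Fin p) :
    shift π j q = if (π.symm q : ℕ) < j then 1 else 0 := by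
  rw [shift, Finset.sum_apply]
  simp_rw [Pi.single_apply, ← Equiv.symm_apply_eq]
  rw [Finset.sum_ite_eq]
  simp

lemma prod_perm_lt (π : Equiv.Perm (Fin p)) (j : ℕ) (f : Fin p → ℝ) :
    ∏ q, (if (π.symm q : ℕ) < j then f q else 1)
      = ∏ l ∈ Finset.univ.filter (fun l : Fin p => (l : ℕ) < j), f (π l) := by
  rw [Finset.prod_filter, ← Equiv.prod_comp π]
  simp

lemma eval_omega_add_shift (α : Fin p → ℝ) (π : Equiv.Perm (Fin p)) (n : Fin p → ℕ) (j : ℕ)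
    (u : ℝ) : (omega α (n + shift π j)).eval u = (omega α n).eval u
      * ∏ l ∈ Finset.univ.filter (fun l : Fin p => (l : ℕ) < j),
          (u - (α (π l) + n (π l))) := by
  rw [eval_omega, eval_omega, ← prod_perm_lt π j (fun q => u - (α q + n q)),
    ← Finset.prod_mul_distrib]
  refine Finset.prod_congr rfl fun q _ => ?_
  rw [Pi.add_apply, shift_apply]
  split_ifs
  · rw [Finset.prod_range_succ, sub_sub u]
  · simp

lemma eval_omega_add_single (α : Fin p → ℝ) (n : Fin p → ℕ) (k : Fin p) (u : ℝ) :
    (omega α (n + Pi.single k 1)).eval u = (omega α n).eval u * (u - (α k + n k)) := by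
  rw [eval_omega, eval_omega, ← Finset.mul_prod_erase _ _ (Finset.mem_univ k),
    ← Finset.mul_prod_erase (a := k) _ (fun q => ∏ m ∈ Finset.range (n q), (u - α q - m))
      (Finset.mem_univ k)]
  have : ∏ q ∈ Finset.univ.erase k, ∏ m ∈ Finset.range ((n + Pi.single k 1 : Fin p → ℕ) q), (u - α q - m)
      = ∏ q ∈ Finset.univ.erase k, ∏ m ∈ Finset.range (n q), (u - α q - m) :=
    Finset.prod_congr rfl fun q hq => by
      simp [Pi.single_eq_of_ne (Finset.ne_of_mem_erase hq)]
  rw [this]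
  simp only [Pi.add_apply, Pi.single_eq_same, Finset.prod_range_succ]
  ring

/-- Shifting `u` moves each block of zeros up by one, so only the two ends of the block differ. The
product form stays valid at the zeros. -/
lemma eval_omega_sub_one (α : Fin p → ℝ) (n : Fin p → ℕ) (u : ℝ) :
    (omega α n).eval (u - 1) * ∏ q, (u - α q)
      = (omega α n).eval u * ∏ q, (u - (α q + n q)) := by
  rw [eval_omega, eval_omega, ← Finset.prod_mul_distrib, ← Finset.prod_mul_distrib]
  refine Finset.prod_congr rfl fun q _ => ?_
  have := (Finset.prod_range_succ (fun m : ℕ => u - α q - (m : ℝ)) (n q)).symm.trans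
    (Finset.prod_range_succ' (fun m : ℕ => u - α q - (m : ℝ)) (n q))
  simp only [Nat.cast_zero, sub_zero] at this
  rw [← sub_sub u, this]
  congr 1
  refine Finset.prod_congr rfl fun m _ => ?_
  push_cast; ring

/-- The constant `∑ (a_q - α_q)` is the one that makes the coefficients of `X^p` agree. -/
lemma X_mul_prod_sub_degree_lt (α a : Fin p → ℝ) :
    (X * ∏ q, (X - C (α q)) - (X + C (∑ q, (a q - α q))) * ∏ q, (X - C (a q)) : ℝ[X]).degree
      < (p : WithBot ℕ) := by
  rcases Nat.eq_zero_or_pos p with rfl | hp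
  · simp
  have deg : ∀ b : Fin p → ℝ, (∏ q, (X - C (b q))).natDegree = p := fun b => by
    simp
  have mon : ∀ b : Fin p → ℝ, (∏ q, (X - C (b q))).Monic := fun b =>
    monic_prod_of_monic _ _ fun q _ => monic_X_sub_C (b q)
  have top : ∀ b : Fin p → ℝ, (∏ q, (X - C (b q))).coeff p = 1 := fun b => by
    have := (mon b).coeff_natDegree
    rwa [deg] at this
  have pred : ∀ b : Fin p → ℝ, (∏ q, (X - C (b q))).coeff (p - 1) = - ∑ q, b q := fun b => by
    simpa using prod_X_sub_C_coeff_card_pred Finset.univ b (by simpa using hp)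
  have big : ∀ (b : Fin p → ℝ) (m : ℕ), p < m → (∏ q, (X - C (b q))).coeff m = 0 := fun b m hm =>
    coeff_eq_zero_of_natDegree_lt (by rwa [deg])
  rw [degree_lt_iff_coeff_zero]
  intro m hm
  obtain ⟨m, rfl⟩ : ∃ k, m = k + 1 := ⟨m - 1, by omega⟩
  rw [add_mul, coeff_sub, coeff_add, coeff_X_mul, coeff_X_mul, coeff_C_mul]
  rcases hm.lt_or_eq with h | h
  · rw [big _ _ h]
    rcases (Nat.lt_succ_iff.mp h).lt_or_eq with h' | rfl
    · rw [big _ _ h', big _ _ h']; ring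
    · rw [top, top]; ring
  · obtain rfl : m = p - 1 := by omega
    rw [pred, pred, Nat.sub_add_cancel hp, top, Finset.sum_sub_distrib]; ring

/-- The remainder of degree below `p` is recovered from its values at the `a_i` by barycentric
Lagrange interpolation, which is its partial fraction expansion. -/
lemma mul_prod_sub_eq_partial_fractions (α : Fin p → ℝ) {a : Fin p → ℝ}
    (ha : Function.Injective a) {u : ℝ} (hu : ∀ q, u ≠ a q) :
    u * ∏ q, (u - α q) = (u + ∑ q, (a q - α q)
      + ∑ i, (a i * ∏ q, (a i - α q)) / (∏ q ∈ Finset.univ.erase i, (a i - a q)) / (u - a i))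
        * ∏ q, (u - a q) := by
  have h := X_mul_prod_sub_degree_lt α a
  set P : ℝ[X] := X * ∏ q, (X - C (α q)) - (X + C (∑ q, (a q - α q))) * ∏ q, (X - C (a q))
  have h1 := Lagrange.eq_interpolate (s := Finset.univ) (v := a) ha.injOn (f := P) (by simpa using h)
  have h2 := Lagrange.eval_interpolate_not_at_node (s := Finset.univ) (v := a)
    (fun i => P.eval (a i)) (x := u) (fun i _ => hu i)
  rw [← h1, Lagrange.eval_nodal] at h2
  have h3 : ∀ i, P.eval (a i) = a i * ∏ q, (a i - α q) := fun i => by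
    have h0 : ∏ q, (a i - a q) = 0 := Finset.prod_eq_zero (Finset.mem_univ i) (sub_self (a i))
    simp [P, eval_prod, h0]
  have h4 : P.eval u = u * ∏ q, (u - α q) - (u + ∑ q, (a q - α q)) * ∏ q, (u - a q) := by
    simp [P, eval_prod, eval_finsetSum]
  rw [h4, sub_eq_iff_eq_add] at h2
  have h5 : ∑ i, Lagrange.nodalWeight Finset.univ a i * (u - a i)⁻¹ * P.eval (a i)
      = ∑ i, (a i * ∏ q, (a i - α q)) / (∏ q ∈ Finset.univ.erase i, (a i - a q)) / (u - a i) := by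
    refine Finset.sum_congr rfl fun i _ => ?_
    rw [h3, Lagrange.nodalWeight, Finset.prod_inv_distrib]
    ring
  rw [h2, h5]
  ring

/-- The residue at `α_i + n_i` of `u ∏_q (u - α_q) / (u - α_q - n_q)`. -/
def recResidue (α : Fin p → ℝ) (n : Fin p → ℕ) (i : Fin p) : ℝ :=
  ((α i + n i) * ∏ q, (α i - α q + n i)) / ∏ q ∈ Finset.univ.erase i, (α i - α q + n i - n q)

lemma top_injective {α : Fin p → ℝ} (hdiff : ∀ i j, i ≠ j → ∀ z : ℤ, α i - α j ≠ z)
    (n : Fin p → ℕ) : Function.Injective fun q => α q + (n q : ℝ) := by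
  intro i j h
  have : (⟨i, n i⟩ : Σ _ : Fin p, ℕ) = ⟨j, n j⟩ := node_injective hdiff h
  exact congrArg Sigma.fst this

lemma mul_prod_sub_eq {α : Fin p → ℝ} (hdiff : ∀ i j, i ≠ j → ∀ z : ℤ, α i - α j ≠ z)
    (n : Fin p → ℕ) {u : ℝ} (hu : ∀ q, u ≠ α q + n q) :
    u * ∏ q, (u - α q) = (u + len n + ∑ i, recResidue α n i / (u - (α i + n i)))
        * ∏ q, (u - (α q + n q)) := by
  rw [mul_prod_sub_eq_partial_fractions α (top_injective hdiff n) hu]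
  have h1 : ∑ q, (α q + n q - α q) = len n := by simp [len]
  rw [h1]
  congr 2
  · refine Finset.sum_congr rfl fun i _ => ?_
    have e1 : ∏ q, (α i - α q + n i) = ∏ q, (α i + n i - α q) :=
      Finset.prod_congr rfl fun q _ => by ring
    have e2 : ∏ q ∈ Finset.univ.erase i, (α i - α q + n i - n q)
        = ∏ q ∈ Finset.univ.erase i, (α i + n i - (α q + n q)) :=
      Finset.prod_congr rfl fun q _ => by ring
    rw [recResidue, e1, e2]

/-- The product in `b^0` is the rational function at `u = α_k + n_k + 1`, and the sum in `b^0` is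
minus its polar part there; only the polynomial part `u + |n|` survives. -/
lemma lagB0_eq {α : Fin p → ℝ} (hdiff : ∀ i j, i ≠ j → ∀ z : ℤ, α i - α j ≠ z)
    (n : Fin p → ℕ) (k : Fin p) : lagB0 α n k = len n + (α k + n k + 1) := by
  have hu : ∀ q, α k + n k + 1 ≠ α q + n q := by
    intro q h
    have : (⟨k, n k + 1⟩ : Σ _ : Fin p, ℕ) = ⟨q, n q⟩ := node_injective hdiff (by
      simp only [node]; push_cast; linarith)
    obtain rfl : k = q := congrArg Sigma.fst this
    linarith
  have h := mul_prod_sub_eq hdiff n hu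
  have hne : ∏ q, (α k + n k + 1 - (α q + n q)) ≠ 0 :=
    Finset.prod_ne_zero_iff.mpr fun q _ => sub_ne_zero.mpr (hu q)
  have e1 : (α k + n k + 1) * ∏ q, (α k - α q + n k + 1) / (α k - α q + n k + 1 - n q)
      = α k + n k + 1 + len n + ∑ i, recResidue α n i / (α k + n k + 1 - (α i + n i)) := by
    rw [← div_eq_iff hne] at h
    rw [← h, mul_div_assoc, ← Finset.prod_div_distrib]
    congr 1
    refine Finset.prod_congr rfl fun q _ => ?_
    congr 1 <;> ring
  have e2 : ∑ i, (α i + n i) / (α i - α k - n k + n i - 1)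
        * ((∏ q, (α i - α q + n i)) / ∏ q ∈ Finset.univ.erase i, (α i - α q + n i - n q))
      = - ∑ i, recResidue α n i / (α k + n k + 1 - (α i + n i)) := by
    rw [← Finset.sum_neg_distrib]
    refine Finset.sum_congr rfl fun i _ => ?_
    rw [recResidue, show α i - α k - n k + n i - 1 = -(α k + n k + 1 - (α i + n i)) by ring, div_neg]
    ring
  rw [lagB0, e1, e2]
  ring

lemma prod_filter_lt_succ (f : Fin p → ℝ) {j : ℕ} (hj : j < p) :
    ∏ l ∈ Finset.univ.filter (fun l : Fin p => (l : ℕ) < j + 1), f l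
      = f ⟨j, hj⟩ * ∏ l ∈ Finset.univ.filter (fun l : Fin p => (l : ℕ) < j), f l := by
  rw [← Finset.prod_insert (by simp)]
  congr 1
  ext l
  simp only [Finset.mem_filter, Finset.mem_univ, true_and, Finset.mem_insert, Fin.ext_iff]
  omega

/-- Newton interpolation of `x ↦ 1/(u-x)` at the points `c_l`, with remainder. For `m = p` the
remainder vanishes once `x` is one of the `c_l`. -/
lemma one_div_sub_eq_newton (c : Fin p → ℝ) {u x : ℝ} (hu : ∀ l, u ≠ c l) (hx : u ≠ x) {m : ℕ}
    (hm : m ≤ p) :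
    1 / (u - x) = ∑ j ∈ Finset.range m,
        (∏ l ∈ Finset.univ.filter (fun l : Fin p => (l : ℕ) < j), (x - c l))
          / ∏ l ∈ Finset.univ.filter (fun l : Fin p => (l : ℕ) < j + 1), (u - c l)
      + (∏ l ∈ Finset.univ.filter (fun l : Fin p => (l : ℕ) < m), (x - c l))
          / (∏ l ∈ Finset.univ.filter (fun l : Fin p => (l : ℕ) < m), (u - c l)) / (u - x) := by
  induction m with
  | zero => simp
  | succ m ih =>
    have hm' : m < p := hm
    rw [ih hm'.le, Finset.sum_range_succ, prod_filter_lt_succ _ hm', prod_filter_lt_succ _ hm']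
    have h1 : ∏ l ∈ Finset.univ.filter (fun l : Fin p => (l : ℕ) < m), (u - c l) ≠ 0 :=
      Finset.prod_ne_zero_iff.mpr fun l _ => sub_ne_zero.mpr (hu l)
    have h2 := sub_ne_zero.mpr (hu ⟨m, hm'⟩)
    have h3 := sub_ne_zero.mpr hx
    rw [add_assoc]
    congr 1
    field_simp
    ring

/-- The Newton numerator cancels the denominators of the first `j` indices along `π`, leaving those
of `S(π, j+1)`; it vanishes when `i` is itself among the first `j`. -/
lemma lagB_succ_eq {α : Fin p → ℝ} (hdiff : ∀ i j, i ≠ j → ∀ z : ℤ, α i - α j ≠ z)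
    (π : Equiv.Perm (Fin p)) (n : Fin p → ℕ) (j : ℕ) :
    lagB α π n (j + 1) = ∑ i, recResidue α n i
      * ∏ l ∈ Finset.univ.filter (fun l : Fin p => (l : ℕ) < j),
          (α i + n i - (α (π l) + n (π l))) := by
  have hne : ∀ i, ∀ q ∈ Finset.univ.erase i, α i - α q + n i - n q ≠ 0 := fun i q hq h =>
    Finset.ne_of_mem_erase hq (top_injective hdiff n (by simp only; linarith))
  rw [lagB, ← Finset.sum_subset (Finset.subset_univ (setS π (j + 1)))]
  · refine Finset.sum_congr rfl fun i hi => ?_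
    have e1 : ∏ q ∈ Finset.univ.erase i, (α i - α q + n i - n q)
        = (∏ q ∈ (setS π (j + 1)).erase i, (α i - α q + n i - n q))
          * ∏ l ∈ Finset.univ.filter (fun l : Fin p => (l : ℕ) < j),
            (α i + n i - (α (π l) + n (π l))) := by
      have e0 : ∏ l ∈ Finset.univ.filter (fun l : Fin p => (l : ℕ) < j),
            (α i + n i - (α (π l) + n (π l)))
          = ∏ q ∈ Finset.univ.filter (fun q => (π.symm q : ℕ) < j), (α i - α q + n i - n q) := by
        rw [← prod_perm_lt π j (fun q => α i + n i - (α q + n q)), ← Finset.prod_filter]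
        exact Finset.prod_congr rfl fun q _ => by ring
      rw [e0, ← Finset.prod_union]
      · congr 1
        · ext q
          simp only [setS, Finset.mem_erase, Finset.mem_union, Finset.mem_filter, Finset.mem_univ,
            true_and, and_true] at hi ⊢
          constructor
          · intro h
            by_cases h' : (π.symm q : ℕ) < j
            · exact Or.inr h'
            · exact Or.inl ⟨h, by omega⟩
          · rintro (h | h)
            · exact h.1
            · rintro rfl; omega
      · rw [Finset.disjoint_left]
        intro q hq
        simp only [setS, Finset.mem_erase, Finset.mem_filter, Finset.mem_univ, true_and] at hq ⊢
        omega
    have h0 := Finset.prod_ne_zero_iff.mpr (hne i)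
    rw [recResidue, e1]
    rw [e1] at h0
    have h1 := left_ne_zero_of_mul h0
    have h2 := right_ne_zero_of_mul h0
    field_simp
  · intro i _ hi
    rw [Finset.prod_eq_zero (i := π.symm i), mul_zero]
    · simp only [setS, Finset.mem_filter, Finset.mem_univ, true_and] at hi ⊢
      omega
    · simp

lemma sum_Icc_one_eq_sum_range {M : Type*} [AddCommMonoid M] (f : ℕ → M) (p : ℕ) :
    ∑ j ∈ Finset.Icc 1 p, f j = ∑ j ∈ Finset.range p, f (j + 1) := by
  rw [Finset.range_eq_Ico, Finset.sum_Ico_add', zero_add, Finset.Ico_add_one_right_eq_Icc]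

lemma sum_recResidue_div {α : Fin p → ℝ} (hdiff : ∀ i j, i ≠ j → ∀ z : ℤ, α i - α j ≠ z)
    (π : Equiv.Perm (Fin p)) (n : Fin p → ℕ) {u : ℝ} (hu : ∀ q, u ≠ α q + n q) :
    ∑ i, recResidue α n i / (u - (α i + n i)) = ∑ j ∈ Finset.Icc 1 p, lagB α π n j
      / ∏ l ∈ Finset.univ.filter (fun l : Fin p => (l : ℕ) < j), (u - (α (π l) + n (π l))) := by
  rw [sum_Icc_one_eq_sum_range]
  simp_rw [lagB_succ_eq hdiff, Finset.sum_div]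
  rw [Finset.sum_comm]
  refine Finset.sum_congr rfl fun i _ => ?_
  have h := one_div_sub_eq_newton (fun l => α (π l) + n (π l)) (fun l => hu (π l)) (hu i) le_rfl
  rw [Finset.prod_eq_zero (i := π.symm i) (by simp) (by simp), zero_div, zero_div, add_zero] at h
  rw [div_eq_mul_one_div, h, Finset.mul_sum]
  simp_rw [mul_div_assoc]

/-- Only the entries over `S(π, j)` matter, and `s_{j-1}` vanishes there; hence `b^j` is the same at
`n + s_{j-1}` as at `n`. -/
lemma lagB_congr {α : Fin p → ℝ} {π : Equiv.Perm (Fin p)} {n m : Fin p → ℕ} {j : ℕ}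
    (h : ∀ i ∈ setS π j, n i = m i) : lagB α π n j = lagB α π m j := by
  rw [lagB, lagB]
  refine Finset.sum_congr rfl fun i hi => ?_
  rw [h i hi]
  congr 1
  exact Finset.prod_congr rfl fun q hq => by rw [h q (Finset.mem_of_mem_erase hq)]

/-! ### Nearest-neighbour recurrences -/

lemma omega_ne_zero (α : Fin p → ℝ) (n : Fin p → ℕ) : omega α n ≠ 0 :=
  Lagrange.nodal_monic.ne_zero

lemma eventually_eval_ne_zero {P : ℝ[X]} (hP : P ≠ 0) (t : ℝ) : ∀ᶠ u in 𝓝[≠] t, P.eval u ≠ 0 := by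
  have h : Set.Finite {u | P.eval u = 0} := by
    refine P.roots.toFinset.finite_toSet.subset fun u hu => ?_
    simpa [hP] using hu
  have h' : {u | P.eval u = 0}ᶜ ∪ {t} ∈ 𝓝 t := by
    have : ({u | P.eval u = 0} \ {t})ᶜ ∈ 𝓝 t :=
      (h.subset Set.sdiff_subset).isClosed.isOpen_compl.mem_nhds (by simp)
    convert this using 1
    ext; simp; tauto
  rw [eventually_nhdsWithin_iff]
  filter_upwards [h'] with u hu hut
  exact hu.resolve_right hut

/-- The common source of both recurrences. The index `k` is auxiliary: it only splits `u + |n|` as a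
linear factor plus `b^0_n(k)`. -/
lemma mul_eval_omega_eq {α : Fin p → ℝ} (hdiff : ∀ i j, i ≠ j → ∀ z : ℤ, α i - α j ≠ z)
    (π : Equiv.Perm (Fin p)) (n : Fin p → ℕ) (k : Fin p) {u : ℝ} (hu : ∀ q, u ≠ α q + n q)
    (hu' : ∀ q, u ≠ α q) :
    u * (omega α n).eval u = (u - (α k + n k) - 1 + lagB0 α n k
      + ∑ j ∈ Finset.Icc 1 p, lagB α π n j
        / ∏ l ∈ Finset.univ.filter (fun l : Fin p => (l : ℕ) < j), (u - (α (π l) + n (π l))))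
          * (omega α n).eval (u - 1) := by
  have h1 := eval_omega_sub_one α n u
  have h2 := mul_prod_sub_eq hdiff n hu
  have n1 : ∏ q, (u - α q) ≠ 0 := Finset.prod_ne_zero_iff.mpr fun q _ => sub_ne_zero.mpr (hu' q)
  rw [← sum_recResidue_div hdiff π n hu, lagB0_eq hdiff]
  refine mul_right_cancel₀ n1 ?_
  calc _ = (u * ∏ q, (u - α q)) * (omega α n).eval u := by ring
    _ = (u + len n + ∑ i, recResidue α n i / (u - (α i + n i)))
        * ((omega α n).eval u * ∏ q, (u - (α q + n q))) := by rw [h2]; ring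
    _ = _ := by rw [← h1]; ring

lemma typeIIRecurrence_lagII {α : Fin p → ℝ} (hα : ∀ i, -1 < α i)
    (hdiff : ∀ i j, i ≠ j → ∀ z : ℤ, α i - α j ≠ z) (π : Equiv.Perm (Fin p)) (n : Fin p → ℕ)
    (k : Fin p) (hn : ∀ i j : Fin p, i ≤ j → n (π i) = 0 → n (π j) = 0) :
    TypeIIRecurrence (lagII α) (lagB0 α) (lagB α) π n k := by
  classical
  refine mellin_injective (Polynomial.eq_of_infinite_eval_eq _ _ ?_)
  -- The transforms are polynomials, so it is enough to compare them off the finitely many excluded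
  -- values of `u`.
  have hW : (∏ q, (X - C (α q + n q)) * (X - C (α q)) : ℝ[X]) ≠ 0 :=
    Finset.prod_ne_zero_iff.mpr fun q _ => mul_ne_zero (X_sub_C_ne_zero _) (X_sub_C_ne_zero _)
  refine (Set.Infinite.mono ?_ ((Set.Finite.infinite_compl
    ((∏ q, (X - C (α q + n q)) * (X - C (α q)) : ℝ[X]).roots.toFinset.finite_toSet))))
  intro u hu
  simp only [Finset.mem_coe, Set.mem_compl_iff, Multiset.mem_toFinset, mem_roots hW, IsRoot.def,
    eval_prod, Finset.prod_eq_zero_iff, Finset.mem_univ, true_and, eval_mul, eval_sub, eval_X,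
    eval_C, mul_eq_zero, not_exists, not_or, sub_eq_zero] at hu
  have h := mul_eval_omega_eq hdiff π n k (fun q => (hu q).1) (fun q => (hu q).2)
  simp only [Set.mem_ofPred_eq, map_add, map_sum, eval_add, eval_finsetSum]
  have e1 : ∀ (c : ℝ) (P : ℝ[X]), (mellin (C c * P)).eval u = c * (mellin P).eval u := fun c P => by
    rw [← smul_eq_C_mul, map_smul, eval_smul, smul_eq_mul]
  rw [mellin_eval_X_mul, e1, mellin_lagII_eval α hα, mellin_lagII_eval α hα, mellin_lagII_eval α hα,
    add_sub_cancel_right, h, eval_omega_add_single, add_mul, add_mul, Finset.sum_mul]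
  congr 1
  · ring
  refine Finset.sum_congr rfl fun j hj => ?_
  rw [Finset.mem_Icc] at hj
  split_ifs with hs
  · obtain ⟨m, rfl⟩ : ∃ m, n = m + shift π j := ⟨n - shift π j, (tsub_add_cancel_of_le hs).symm⟩
    rw [e1, mellin_lagII_eval α hα, add_tsub_cancel_right, eval_omega_add_shift]
    have e2 : ∏ l ∈ Finset.univ.filter (fun l : Fin p => (l : ℕ) < j),
          (u - 1 - (α (π l) + m (π l))) = ∏ l ∈ Finset.univ.filter (fun l : Fin p => (l : ℕ) < j),
          (u - (α (π l) + (m + shift π j) (π l) : ℝ)) := by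
      refine Finset.prod_congr rfl fun l hl => ?_
      simp only [Finset.mem_filter, Finset.mem_univ, true_and] at hl
      simp [shift_apply, hl]
      ring
    have n1 : ∏ l ∈ Finset.univ.filter (fun l : Fin p => (l : ℕ) < j),
          (u - (α (π l) + (m + shift π j) (π l) : ℝ)) ≠ 0 :=
      Finset.prod_ne_zero_iff.mpr fun l _ => sub_ne_zero.mpr (hu _).1
    rw [e2]
    field_simp
  -- A zero entry among the first `j` along `π` forces `n_i = 0` on all of `S(π, j)`, and then the
  -- factor `q = i` of each numerator is zero.
  · have : lagB α π n j = 0 := by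
      simp only [Pi.le_def, not_forall, not_le, shift_apply] at hs
      obtain ⟨q, hq⟩ := hs
      have hq' : (π.symm q : ℕ) < j ∧ n q = 0 := by
        split_ifs at hq with h
        · exact ⟨h, by omega⟩
        · omega
      refine Finset.sum_eq_zero fun i hi => ?_
      simp only [setS, Finset.mem_filter, Finset.mem_univ, true_and] at hi
      have : n i = 0 := by
        have := hn (π.symm q) (π.symm i) (Fin.le_def.mpr (by omega)) (by simpa using hq'.2)
        simpa using this
      rw [Finset.prod_eq_zero (Finset.mem_univ i) (by simp [this]), mul_zero, zero_div]
    simp [this]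

/-- Residues as limits let an identity of rational functions near a node pass to coefficients; for
`l ≥ n_i` there is no pole and the limit is the default value `0`. -/
lemma tendsto_residue {α : Fin p → ℝ} (hdiff : ∀ i j, i ≠ j → ∀ z : ℤ, α i - α j ≠ z)
    (n : Fin p → ℕ) (i : Fin p) (l : ℕ) :
    Tendsto (fun u => (u - (α i + l)) / (omega α n).eval u) (𝓝[≠] (α i + l))
      (𝓝 (residue α n i l)) := by
  rw [residue]
  split_ifs with hl
  · have hx : (⟨i, l⟩ : Σ _ : Fin p, ℕ) ∈ nodes n := by simpa using hl
    have hn : Lagrange.nodalWeight (nodes n) (node α) ⟨i, l⟩ ≠ 0 :=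
      Lagrange.nodalWeight_ne_zero (node_injective hdiff).injOn hx
    rw [Lagrange.nodalWeight_eq_eval_nodal_erase_inv] at hn ⊢
    have ht : Tendsto (fun u => ((Lagrange.nodal ((nodes n).erase ⟨i, l⟩) (node α)).eval u)⁻¹)
        (𝓝 (α i + l)) (𝓝 ((Lagrange.nodal ((nodes n).erase ⟨i, l⟩) (node α)).eval (α i + l))⁻¹) :=
      ((Polynomial.continuous _).tendsto _).inv₀ (fun h => hn (inv_eq_zero.mpr h))
    refine (ht.mono_left nhdsWithin_le_nhds).congr' ?_
    filter_upwards [self_mem_nhdsWithin] with u hu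
    have hu : u - (α i + l) ≠ 0 := sub_ne_zero.mpr hu
    rw [omega, Lagrange.nodal_eq_mul_nodal_erase hx, eval_mul, eval_sub, eval_X, eval_C, node]
    rw [div_mul_eq_div_div, div_self hu, one_div]
  · have hn : (omega α n).eval (α i + l) ≠ 0 := by
      refine Lagrange.eval_nodal_not_at_node fun x hx h => hl ?_
      have : (⟨i, l⟩ : Σ _ : Fin p, ℕ) = x := node_injective hdiff h
      rw [← this] at hx
      simpa using hx
    have : Tendsto (fun u => (u - (α i + l)) / (omega α n).eval u) (𝓝 (α i + l))
        (𝓝 ((α i + l - (α i + l)) / (omega α n).eval (α i + l))) :=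
      (tendsto_id.sub_const _).div ((Polynomial.continuous _).tendsto _) hn
    rw [sub_self, zero_div] at this
    exact this.mono_left nhdsWithin_le_nhds

/-- The coefficient of `x ^ (α_i + l)` in `x` times the linear form, up to `Γ(α_i + l + 1)`. -/
lemma tendsto_mul_residue {α : Fin p → ℝ} (hdiff : ∀ i j, i ≠ j → ∀ z : ℤ, α i - α j ≠ z)
    (n : Fin p → ℕ) (i : Fin p) (l : ℕ) :
    Tendsto (fun u => (u - (α i + l)) * (u / (omega α n).eval (u - 1))) (𝓝[≠] (α i + l))
      (𝓝 (if l = 0 then 0 else (α i + l) * residue α n i (l - 1))) := by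
  have hid : Tendsto (fun u : ℝ => u) (𝓝[≠] (α i + l)) (𝓝 (α i + l)) :=
    tendsto_id.mono_left nhdsWithin_le_nhds
  split_ifs with hl
  · subst hl
    simp only [Nat.cast_zero, add_zero] at hid ⊢
    have hn : (omega α n).eval (α i - 1) ≠ 0 := by
      refine Lagrange.eval_nodal_not_at_node fun x hx h => ?_
      have : (⟨i, 0⟩ : Σ _ : Fin p, ℕ) = ⟨x.1, x.2 + 1⟩ := node_injective hdiff (by
        simp only [node] at h ⊢; push_cast; linarith)
      simp only [Sigma.mk.injEq, heq_eq_eq] at this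
      omega
    have : Tendsto (fun u => (u - α i) * (u / (omega α n).eval (u - 1))) (𝓝 (α i))
        (𝓝 ((α i - α i) * (α i / (omega α n).eval (α i - 1)))) :=
      (tendsto_id.sub_const _).mul (tendsto_id.div
        (((Polynomial.continuous _).tendsto _).comp (tendsto_id.sub_const _)) hn)
    rw [sub_self, zero_mul] at this
    exact this.mono_left nhdsWithin_le_nhds
  · obtain ⟨m, rfl⟩ : ∃ m, l = m + 1 := ⟨l - 1, by omega⟩
    have ht : Tendsto (fun u : ℝ => u - 1) (𝓝[≠] (α i + (m + 1 : ℕ))) (𝓝[≠] (α i + m)) := by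
      refine tendsto_nhdsWithin_iff.mpr ⟨?_, ?_⟩
      · convert hid.sub_const 1 using 2
        push_cast; ring
      · filter_upwards [self_mem_nhdsWithin] with u hu h
        refine hu ?_
        have h : u - 1 = α i + m := h
        simp only [Set.mem_singleton_iff]
        push_cast; linarith
    refine (hid.mul ((tendsto_residue hdiff n i m).comp ht)).congr fun u => ?_
    simp only [Function.comp]
    push_cast
    ring

lemma typeIRecurrence_lagI {α : Fin p → ℝ} (hα : ∀ i, -1 < α i)
    (hdiff : ∀ i j, i ≠ j → ∀ z : ℤ, α i - α j ≠ z) (π : Equiv.Perm (Fin p)) (n : Fin p → ℕ)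
    (k : Fin p) (hn : 1 ≤ n k) :
    TypeIRecurrence (lagI α) (lagB0 α) (lagB α) π n k := by
  intro i
  obtain ⟨m, rfl⟩ : ∃ m, n = m + Pi.single k 1 := ⟨n - Pi.single k 1, by
    refine (tsub_add_cancel_of_le fun q => ?_).symm
    rcases eq_or_ne q k with rfl | h
    · simpa using hn
    · simp [h]⟩
  rw [add_tsub_cancel_right]
  set n := m + Pi.single k 1 with hnm
  -- Both `|n|` and `n_k` drop by one. The same `2` appears when `u - α_k - n_k - 1` is rewritten
  -- through `u - α_k - m_k`.
  have hb0 : lagB0 α m k = lagB0 α n k - 1 - 1 := by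
    rw [lagB0_eq hdiff, lagB0_eq hdiff, hnm]
    simp [len, Finset.sum_add_distrib]
    ring
  have hb : ∀ j, lagB α π (n + shift π (j - 1)) j = lagB α π n j := fun j => by
    refine lagB_congr fun q hq => ?_
    simp only [setS, Finset.mem_filter, Finset.mem_univ, true_and] at hq
    rw [Pi.add_apply, shift_apply, if_neg (by omega), add_zero]
  simp_rw [hb, hb0]
  -- The recurrence for residues at `α_i + l`; dividing by `Γ(α_i+l+1)` makes it the recurrence for
  -- coefficients.
  have key : ∀ l : ℕ, (if l = 0 then 0 else (α i + l) * residue α n i (l - 1))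
      = residue α m i l + (lagB0 α n k - 1 - 1) * residue α n i l
        + ∑ j ∈ Finset.Icc 1 p, lagB α π n j * residue α (n + shift π j) i l := by
    intro l
    refine tendsto_nhds_unique (tendsto_mul_residue hdiff n i l) ?_
    have ht := ((tendsto_residue hdiff m i l).add
      ((tendsto_residue hdiff n i l).const_mul (lagB0 α n k - 1 - 1))).add
      (tendsto_finsetSum (Finset.Icc 1 p) fun j _ =>
        (tendsto_residue hdiff (n + shift π j) i l).const_mul (lagB α π n j))
    refine ht.congr' ?_
    have hW : (∏ q, (X - C (α q + n q)) * (X - C (α q)) : ℝ[X]) ≠ 0 :=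
      Finset.prod_ne_zero_iff.mpr fun q _ => mul_ne_zero (X_sub_C_ne_zero _) (X_sub_C_ne_zero _)
    filter_upwards [eventually_eval_ne_zero hW (α i + l),
      eventually_eval_ne_zero (omega_ne_zero α n) (α i + l)] with u hu hω
    simp only [eval_prod, Finset.prod_ne_zero_iff, Finset.mem_univ, forall_const, eval_mul,
      eval_sub, eval_X, eval_C, mul_ne_zero_iff, sub_ne_zero] at hu
    have h := mul_eval_omega_eq hdiff π n k (fun q => (hu q).1) (fun q => (hu q).2)
    have n1 : (omega α n).eval (u - 1) ≠ 0 := by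
      have h1 := eval_omega_sub_one α n u
      have : (omega α n).eval u * ∏ q, (u - (α q + n q)) ≠ 0 :=
        mul_ne_zero hω (Finset.prod_ne_zero_iff.mpr fun q _ => sub_ne_zero.mpr (hu q).1)
      rw [← h1] at this
      exact left_ne_zero_of_mul this
    have e1 : u / (omega α n).eval (u - 1) = (u - (α k + n k) - 1 + lagB0 α n k
      + ∑ j ∈ Finset.Icc 1 p, lagB α π n j
        / ∏ l ∈ Finset.univ.filter (fun l : Fin p => (l : ℕ) < j), (u - (α (π l) + n (π l))))
          / (omega α n).eval u := by
      rw [div_eq_div_iff n1 hω, h]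
    have e2 : (omega α m).eval u = (omega α n).eval u / (u - (α k + n k) + 1) := by
      have h2 := eval_omega_add_single α m k u
      rw [← hnm] at h2
      have h3 : u - (α k + n k) + 1 = u - (α k + m k) := by
        rw [hnm]; simp; ring
      rw [h3, h2]
      rw [h2] at hω
      rw [mul_div_cancel_right₀ _ (right_ne_zero_of_mul hω)]
    rw [e1, e2, add_div, Finset.sum_div, mul_add, Finset.mul_sum]
    congr 1
    · rw [div_div_eq_mul_div]
      ring
    · refine Finset.sum_congr rfl fun j _ => ?_
      rw [eval_omega_add_shift]
      simp only [div_eq_mul_inv, mul_inv]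
      ring
  ext l
  rw [coeff_add, coeff_add, finsetSum_coeff, coeff_C_mul]
  simp_rw [coeff_C_mul, coeff_lagI hα hdiff, ← mul_div_assoc]
  rw [← Finset.sum_div, ← add_div, ← add_div, ← key l]
  rcases l with _ | l
  · simp
  · rw [coeff_X_mul, coeff_lagI hα hdiff]
    have hi := hα i
    have hl : (0 : ℝ) ≤ l := l.cast_nonneg
    have hne : α i + l + 1 ≠ 0 := by linarith
    have e : α i + (l + 1 : ℕ) = α i + l + 1 := by push_cast; ring
    rw [if_neg (by omega), Nat.add_sub_cancel, e, Real.Gamma_add_one hne, mul_div_mul_left _ _ hne]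

/-! ### Pairings of type II with type I polynomials -/

/-- The pairing of the polynomial `P` with the type I linear form of multi-index `m`. -/
def pairing (α : Fin p → ℝ) (m : Fin p → ℕ) (P : ℝ[X]) : ℝ :=
  ∑ x ∈ nodes m, Lagrange.nodalWeight (nodes m) (node α) x * (mellin P).eval (node α x + 1)

lemma pairing_add (α : Fin p → ℝ) (m : Fin p → ℕ) (P Q : ℝ[X]) :
    pairing α m (P + Q) = pairing α m P + pairing α m Q := by
  simp [pairing, mul_add, Finset.sum_add_distrib]

lemma pairing_C_mul (α : Fin p → ℝ) (m : Fin p → ℕ) (c : ℝ) (P : ℝ[X]) :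
    pairing α m (C c * P) = c * pairing α m P := by
  rw [pairing, pairing, Finset.mul_sum]
  refine Finset.sum_congr rfl fun x _ => ?_
  rw [← smul_eq_C_mul, map_smul, eval_smul, smul_eq_mul, mul_left_comm]

lemma pairing_sum {ι : Type*} (α : Fin p → ℝ) (m : Fin p → ℕ) (s : Finset ι) (P : ι → ℝ[X]) :
    pairing α m (∑ j ∈ s, P j) = ∑ j ∈ s, pairing α m (P j) := by
  simp_rw [pairing, map_sum, eval_finsetSum, Finset.mul_sum]
  exact Finset.sum_comm

/-- Biorthogonality: since `ω_n` is monic of degree `|n|`, the value is `1` for `|n| = |m| - 1` and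
`0` for smaller `|n|`. -/
lemma pairing_lagII {α : Fin p → ℝ} (hα : ∀ i, -1 < α i)
    (hdiff : ∀ i j, i ≠ j → ∀ z : ℤ, α i - α j ≠ z) {n m : Fin p → ℕ} (h : len n < len m) :
    pairing α m (lagII α n) = (omega α n).coeff (len m - 1) := by
  simp_rw [pairing, mellin_lagII_eval α hα, add_sub_cancel_right]
  refine sum_nodalWeight_mul_eval hdiff m ?_
  rw [omega, Lagrange.degree_nodal, card_nodes]
  exact_mod_cast h

lemma len_add_single (n : Fin p → ℕ) (k : Fin p) : len (n + Pi.single k 1) = len n + 1 := by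
  simp [len, Finset.sum_add_distrib]

lemma len_shift (π : Equiv.Perm (Fin p)) {j : ℕ} (hj : j ≤ p) : len (shift π j) = j := by
  simp_rw [len, shift_apply]
  rw [← Equiv.sum_comp π]
  simp [Fin.card_filter_val_lt, hj]

lemma len_add (n m : Fin p → ℕ) : len (n + m) = len n + len m := by
  simp [len, Finset.sum_add_distrib]

lemma pairing_X_mul_add_single {α : Fin p → ℝ} (hα : ∀ i, -1 < α i)
    (hdiff : ∀ i j, i ≠ j → ∀ z : ℤ, α i - α j ≠ z) (n : Fin p → ℕ) (k : Fin p) :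
    pairing α (n + Pi.single k 1) (X * lagII α n) = lagB0 α n k := by
  classical
  -- `b^0` does not depend on `π`, so a permutation sorting the zero entries of `n` to the end may
  -- be used; the type II recurrence then applies to every `n`.
  let f : Fin p → ℕ := fun i => if n i = 0 then 1 else 0
  have hrec := typeIIRecurrence_lagII hα hdiff (Tuple.sort f) n k (by
    intro i j hij hi
    have := Tuple.monotone_sort f hij
    simp only [Function.comp, f, hi, if_true] at this
    by_contra h
    rw [if_neg h] at this
    omega)
  have hlt : ∀ n' : Fin p → ℕ, len n' < len n →
      pairing α (n + Pi.single k 1) (lagII α n') = 0 := by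
    intro n' h
    rw [pairing_lagII hα hdiff (by rw [len_add_single]; omega), len_add_single]
    refine coeff_eq_zero_of_natDegree_lt ?_
    rw [omega, Lagrange.natDegree_nodal, card_nodes]
    omega
  rw [hrec, pairing_add, pairing_add, pairing_C_mul, pairing_sum]
  have h1 : pairing α (n + Pi.single k 1) (lagII α (n + Pi.single k 1)) = 0 := by
    refine Finset.sum_eq_zero fun x hx => ?_
    rw [mellin_lagII_eval α hα, add_sub_cancel_right, omega, Lagrange.eval_nodal_at_node hx,
      mul_zero]
  have h2 : pairing α (n + Pi.single k 1) (lagII α n) = 1 := by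
    rw [pairing_lagII hα hdiff (by rw [len_add_single]; omega), len_add_single, Nat.add_sub_cancel,
      ← card_nodes, ← Lagrange.natDegree_nodal (s := nodes n) (v := node α)]
    exact Lagrange.nodal_monic.coeff_natDegree
  rw [h1, h2, Finset.sum_eq_zero, zero_add, mul_one, add_zero]
  intro j hj
  rw [Finset.mem_Icc] at hj
  split_ifs with hs
  · rw [pairing_C_mul, hlt, mul_zero]
    have := len_add (n - shift (Tuple.sort f) j) (shift (Tuple.sort f) j)
    rw [tsub_add_cancel_of_le hs, len_shift _ hj.2] at this
    omega
  · simp [pairing]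

/-- With `n = m + s_j`, the simple pole of `1/ω_m(u)` at `α_i + n_i - 1` meets the factor of
`ω_n(u+1)/ω_n(u)` having its pole there. Taking the product as a limit replaces the evaluation by
the telescoped ratio. -/
lemma nodalWeight_mul_eval_omega {α : Fin p → ℝ}
    (hdiff : ∀ i j, i ≠ j → ∀ z : ℤ, α i - α j ≠ z) (π : Equiv.Perm (Fin p)) (m : Fin p → ℕ)
    (j : ℕ) (i : Fin p) {l : ℕ} (hl : l < m i) (hli : l + 1 = (m + shift π j) i) :
    Lagrange.nodalWeight (nodes m) (node α) ⟨i, l⟩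
        * ((α i + l + 1) * (omega α (m + shift π j)).eval (α i + l + 1))
      = recResidue α (m + shift π j) i * ∏ q ∈ Finset.univ.filter (fun q : Fin p => (q : ℕ) < j),
          (α i + (m + shift π j) i - (α (π q) + (m + shift π j) (π q) : ℝ)) := by
  set n := m + shift π j with hnm
  have ht : α i + l + 1 = α i + n i := by rw [← hli]; push_cast; ring
  have h1 := tendsto_residue hdiff m i l
  rw [residue, if_pos hl] at h1
  have h2 : Tendsto (fun u : ℝ => (u + 1) * (omega α n).eval (u + 1)) (𝓝[≠] (α i + l))
      (𝓝 ((α i + l + 1) * (omega α n).eval (α i + l + 1))) := by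
    refine Tendsto.mono_left ?_ nhdsWithin_le_nhds
    exact (Continuous.tendsto (by fun_prop) _)
  refine tendsto_nhds_unique (h1.mul h2) ?_
  have hne : ∏ q ∈ Finset.univ.erase i, (α i + l + 1 - (α q + n q)) ≠ 0 :=
    Finset.prod_ne_zero_iff.mpr fun q hq => by
      rw [ht]
      exact sub_ne_zero.mpr fun h => Finset.ne_of_mem_erase hq (top_injective hdiff n h.symm)
  have h3 : Tendsto (fun u : ℝ => (u + 1) * (∏ q, (u + 1 - α q))
        / (∏ q ∈ Finset.univ.erase i, (u + 1 - (α q + n q)))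
        * ∏ q ∈ Finset.univ.filter (fun q : Fin p => (q : ℕ) < j),
          (u + 1 - (α (π q) + n (π q)))) (𝓝[≠] (α i + l))
      (𝓝 ((α i + l + 1) * (∏ q, (α i + l + 1 - α q))
        / (∏ q ∈ Finset.univ.erase i, (α i + l + 1 - (α q + n q)))
        * ∏ q ∈ Finset.univ.filter (fun q : Fin p => (q : ℕ) < j),
          (α i + l + 1 - (α (π q) + n (π q))))) := by
    refine Tendsto.mono_left ?_ nhdsWithin_le_nhds
    refine Tendsto.mul (Tendsto.div ?_ ?_ hne) ?_ <;> exact Continuous.tendsto (by fun_prop) _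
  have e : recResidue α n i = (α i + l + 1) * (∏ q, (α i + l + 1 - α q))
        / (∏ q ∈ Finset.univ.erase i, (α i + l + 1 - (α q + n q))) := by
    rw [recResidue, ht]
    congr 1
    · congr 1
      exact Finset.prod_congr rfl fun q _ => by ring
    · exact Finset.prod_congr rfl fun q _ => by ring
  rw [e, ← ht]
  refine h3.congr' ?_
  have hW : (∏ q, (X + C 1 - C (α q + n q)) : ℝ[X]) ≠ 0 :=
    Finset.prod_ne_zero_iff.mpr fun q _ => by
      rw [add_sub_assoc, ← C_sub]; exact X_add_C_ne_zero _
  filter_upwards [eventually_eval_ne_zero hW (α i + l),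
    eventually_eval_ne_zero (omega_ne_zero α m) (α i + l)] with u hu hω
  simp only [eval_prod, eval_sub, eval_add, eval_X, eval_C] at hu
  have k1 := eval_omega_sub_one α n (u + 1)
  rw [add_sub_cancel_right, hnm, eval_omega_add_shift, ← hnm] at k1
  have k2 : ∏ q ∈ Finset.univ.filter (fun q : Fin p => (q : ℕ) < j), (u - (α (π q) + m (π q)))
      = ∏ q ∈ Finset.univ.filter (fun q : Fin p => (q : ℕ) < j),
          (u + 1 - (α (π q) + n (π q))) := by
    refine Finset.prod_congr rfl fun q hq => ?_
    simp only [Finset.mem_filter, Finset.mem_univ, true_and] at hq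
    simp [hnm, shift_apply, hq]
    ring
  rw [k2, ← Finset.mul_prod_erase Finset.univ (fun q => u + 1 - (α q + (n q : ℝ)))
    (Finset.mem_univ i), ← ht] at k1
  rw [← Finset.mul_prod_erase _ _ (Finset.mem_univ i)] at hu
  have hu2 := right_ne_zero_of_mul hu
  set E := ∏ q ∈ Finset.univ.erase i, (u + 1 - (α q + (n q : ℝ)))
  set S := ∏ q ∈ Finset.univ.filter (fun q : Fin p => (q : ℕ) < j),
          (u + 1 - (α (π q) + (n (π q) : ℝ)))
  field_simp
  linear_combination (u + 1) * k1

/-- Computed without the recurrence, so the zero entries may lie anywhere. `ω_n` vanishes at `α_i +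
l + 1` unless `l + 1 = n_i`, so each block contributes at most its top node, and blocks among the
first `j` contribute nothing. -/
lemma pairing_X_mul_of_add_shift {α : Fin p → ℝ} (hα : ∀ i, -1 < α i)
    (hdiff : ∀ i j, i ≠ j → ∀ z : ℤ, α i - α j ≠ z) (π : Equiv.Perm (Fin p)) (m : Fin p → ℕ)
    (j : ℕ) : pairing α m (X * lagII α (m + shift π j)) = lagB α π (m + shift π j) (j + 1) := by
  set n := m + shift π j with hnm
  rw [lagB_succ_eq hdiff, pairing, nodes, Finset.sum_sigma]
  rw [← nodes]
  refine Finset.sum_congr rfl fun i _ => ?_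
  have hval : ∀ l, node α ⟨i, l⟩ + 1 = α i + l + 1 := fun l => rfl
  simp_rw [mellin_eval_X_mul, mellin_lagII_eval α hα, add_sub_cancel_right, hval]
  have hz : ∀ l ∈ Finset.range (m i), l + 1 < n i →
      Lagrange.nodalWeight (nodes m) (node α) ⟨i, l⟩
        * ((α i + l + 1) * (omega α n).eval (α i + l + 1)) = 0 := by
    intro l _ h
    have : (omega α n).eval (node α ⟨i, l + 1⟩) = 0 :=
      Lagrange.eval_nodal_at_node (by simpa using h)
    rw [show α i + l + 1 = node α ⟨i, l + 1⟩ by simp only [node]; push_cast; ring, this, mul_zero,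
      mul_zero]
  by_cases hi : (π.symm i : ℕ) < j
  · have hni : n i = m i + 1 := by simp [hnm, shift_apply, hi]
    rw [Finset.prod_eq_zero (i := π.symm i) (by simpa using hi) (by simp), mul_zero]
    refine Finset.sum_eq_zero fun l hl => hz l hl ?_
    have := Finset.mem_range.mp hl
    omega
  · have hni : n i = m i := by simp [hnm, shift_apply, hi]
    rcases Nat.eq_zero_or_pos (n i) with h0 | hpos
    · have : recResidue α n i = 0 := by
        rw [recResidue, Finset.prod_eq_zero (Finset.mem_univ i) (by simp [h0]), mul_zero, zero_div]
      rw [this, zero_mul, ← hni, h0, Finset.range_zero, Finset.sum_empty]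
    · rw [Finset.sum_eq_single_of_mem (n i - 1) (Finset.mem_range.mpr (by omega))
        (fun l hl hne => hz l hl (by have := Finset.mem_range.mp hl; omega))]
      exact nodalWeight_mul_eval_omega hdiff π m j i (by omega) (by rw [← hnm]; omega)

/-! ### Limits of the Jacobi–Piñeiro recurrence coefficients -/

lemma tendsto_poch_add_div_pow (a : ℝ) (m : ℕ) :
    Tendsto (fun β : ℝ => poch (a + β) m / β ^ m) atTop (𝓝 1) := by
  have h : Tendsto (fun β : ℝ => ∏ k ∈ Finset.range m, ((a + k) / β + 1)) atTop
      (𝓝 (∏ _k ∈ Finset.range m, (0 + 1))) :=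
    tendsto_finsetProd _ fun k _ => (tendsto_id.const_div_atTop _).add_const 1
  simp only [zero_add, Finset.prod_const_one] at h
  refine h.congr' ?_
  filter_upwards [eventually_gt_atTop 0] with β hβ
  rw [poch_eq_prod]
  nth_rw 3 [← Finset.card_range m]
  rw [← Finset.prod_const, ← Finset.prod_div_distrib]
  refine Finset.prod_congr rfl fun k _ => ?_
  field_simp
  ring

/-- Factor `q` grows like `β^{-n_q} β^{T_q - T_{q+1}}`, and `T_q - T_{q+1} = l_q`. -/
lemma tendsto_jpCoeffII (α : Fin p → ℝ) (n l : Fin p → ℕ) :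
    Tendsto (fun β : ℝ => jpCoeffII α β n l * (β ^ len n / β ^ (∑ q, l q))) atTop
      (𝓝 (lagCoeffII α n l)) := by
  set f : Fin p → ℝ → ℝ := fun q β =>
    (poch (α q + 1) (n q) * (poch (-(n q : ℝ)) (l q) / (l q).factorial))
      * (poch (α q + n q + 1) (∑ r ∈ Finset.Ioi q, l r) / poch (α q + 1) (∑ r ∈ Finset.Ici q, l r))
      * ((poch ((α q + len n + 1) + β) (n q) / β ^ n q)⁻¹
        * (poch ((α q + (∑ r ∈ Finset.Iic q, n r : ℕ) + 1) + β) (∑ r ∈ Finset.Ici q, l r)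
            / β ^ (∑ r ∈ Finset.Ici q, l r))
        * (poch ((α q + (∑ r ∈ Finset.Iic q, n r : ℕ) + 1) + β) (∑ r ∈ Finset.Ioi q, l r)
            / β ^ (∑ r ∈ Finset.Ioi q, l r))⁻¹)
  have hf : Tendsto (fun β => (-1) ^ len n * ∏ q, f q β) atTop (𝓝 (lagCoeffII α n l)) := by
    rw [lagCoeffII, mul_assoc, ← Finset.prod_mul_distrib]
    refine Tendsto.const_mul _ (tendsto_finsetProd _ fun q _ => ?_)
    have := (((tendsto_poch_add_div_pow (α q + len n + 1) (n q)).inv₀ one_ne_zero).mul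
      (tendsto_poch_add_div_pow (α q + (∑ r ∈ Finset.Iic q, n r : ℕ) + 1)
        (∑ r ∈ Finset.Ici q, l r))).mul
      ((tendsto_poch_add_div_pow (α q + (∑ r ∈ Finset.Iic q, n r : ℕ) + 1)
        (∑ r ∈ Finset.Ioi q, l r)).inv₀ one_ne_zero)
    simpa only [inv_one, mul_one] using this.const_mul _
  refine hf.congr' ?_
  filter_upwards [eventually_gt_atTop 0] with β hβ
  have hn : β ^ len n = ∏ q, β ^ n q := by rw [len, Finset.prod_pow_eq_pow_sum]
  rw [jpCoeffII, hn, ← Finset.prod_pow_eq_pow_sum _ l, ← Finset.prod_div_distrib, mul_assoc,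
    mul_assoc, ← Finset.prod_mul_distrib, ← Finset.prod_mul_distrib]
  congr 1
  refine Finset.prod_congr rfl fun q _ => ?_
  have hT : ∑ r ∈ Finset.Ici q, l r = l q + ∑ r ∈ Finset.Ioi q, l r := by
    rw [← Finset.Ioi_insert, Finset.sum_insert (by simp)]
  have e1 : α q + β + (len n : ℝ) + 1 = α q + len n + 1 + β := by ring
  have e2 : α q + β + (∑ r ∈ Finset.Iic q, n r : ℕ) + 1
      = α q + (∑ r ∈ Finset.Iic q, n r : ℕ) + 1 + β := by ring
  have e3 : β ^ (∑ r ∈ Finset.Ici q, l r) = β ^ l q * β ^ (∑ r ∈ Finset.Ioi q, l r) := by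
    rw [hT, pow_add]
  have hb : β ^ (∑ r ∈ Finset.Ioi q, l r) ≠ 0 := by positivity
  simp only [f]
  rw [e1, e2, e3]
  simp only [div_eq_mul_inv, mul_inv, inv_inv]
  field_simp

lemma coeff_jpI (α : Fin p → ℝ) (β : ℝ) (n : Fin p → ℕ) (i : Fin p) (l : ℕ) :
    (jpI α β n i).coeff l = if l < n i then (-1) ^ (len n - 1)
      * ((∏ q, poch (α q + β + len n) (n q))
          / ((n i - 1).factorial * ∏ q ∈ Finset.univ.erase i, poch (α q - α i) (n q)))
      * (Real.Gamma (α i + β + len n) / (Real.Gamma (β + len n) * Real.Gamma (α i + 1)))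
      * (poch (-(n i : ℝ) + 1) l * poch (α i + β + len n) l / (l.factorial * poch (α i + 1) l)
            * ∏ q ∈ Finset.univ.erase i,
                poch (α i - α q - n q + 1) l / poch (α i - α q + 1) l) else 0 := by
  rw [jpI, coeff_C_mul, finsetSum_coeff]
  simp_rw [coeff_C_mul, coeff_X_pow, mul_ite, mul_one, mul_zero]
  rw [Finset.sum_ite_eq]
  simp

lemma coeff_lagI_of_lt (α : Fin p → ℝ) (n : Fin p → ℕ) (i : Fin p) {l : ℕ} (hl : l < n i) :
    (lagI α n i).coeff l = (-1) ^ (len n - 1)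
      / ((n i - 1).factorial * (∏ q ∈ Finset.univ.erase i, poch (α q - α i) (n q))
          * Real.Gamma (α i + 1))
      * (poch (-(n i : ℝ) + 1) l / l.factorial * (1 / poch (α i + 1) l)
            * ∏ q ∈ Finset.univ.erase i,
                poch (α i - α q - n q + 1) l / poch (α i - α q + 1) l) := by
  rw [lagI, coeff_C_mul, finsetSum_coeff]
  simp_rw [coeff_C_mul, coeff_X_pow, mul_ite, mul_one, mul_zero]
  rw [Finset.sum_ite_eq, if_pos (Finset.mem_range.mpr hl)]

lemma jpI_eq_sum (α : Fin p → ℝ) (β : ℝ) (n : Fin p → ℕ) (i : Fin p) :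
    jpI α β n i = ∑ l ∈ Finset.range (n i), C ((jpI α β n i).coeff l) * X ^ l := by
  ext l
  rw [finsetSum_coeff]
  simp_rw [coeff_C_mul, coeff_X_pow, mul_ite, mul_one, mul_zero]
  rw [Finset.sum_ite_eq]
  split_ifs with h
  · rfl
  · rw [coeff_jpI, if_neg (by simpa using h)]

/-- The `k`-th moment of `x ^ a (1 - x) ^ β`. -/
def betaMoment (a β : ℝ) (k : ℕ) : ℝ :=
  Real.Gamma (a + k + 1) * Real.Gamma (β + 1) / Real.Gamma (a + k + 1 + (β + 1))

/-- Counting powers of `β`: the Pochhammer symbols give `|m| + l`, `Γ(α_i+β+|m|)/Γ(α_i+β+k+2)` gives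
`|m| - k - 2`, and `Γ(β+1)/Γ(β+|m|)` gives `1 - |m|`. -/
lemma tendsto_coeff_jpI_mul_betaMoment (α : Fin p → ℝ) (m : Fin p → ℕ) (i : Fin p) {l : ℕ}
    (hl : l < m i) (k : ℕ) :
    Tendsto (fun β : ℝ => (jpI α β m i).coeff l * betaMoment (α i) β k
      * (β ^ (k + 1) / β ^ (len m + l))) atTop
      (𝓝 ((lagI α m i).coeff l * Real.Gamma (α i + k + 1))) := by
  have hM : 1 ≤ len m := (by omega : 1 ≤ m i).trans
    (Finset.single_le_sum (f := m) (fun _ _ => Nat.zero_le _) (Finset.mem_univ i))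
  obtain ⟨M, hM⟩ : ∃ M, len m = M + 1 := ⟨len m - 1, by omega⟩
  have hlim := (((((tendsto_finsetProd Finset.univ fun q _ =>
      tendsto_poch_add_div_pow (α q + len m) (m q)).mul
      (tendsto_poch_add_div_pow (α i + len m) l)).mul
      (tendsto_poch_add_div_pow (α i) (len m))).mul
      ((tendsto_poch_add_div_pow (α i) (k + 2)).inv₀ one_ne_zero)).mul
      ((tendsto_poch_add_div_pow 1 M).inv₀ one_ne_zero)).const_mul
      ((lagI α m i).coeff l * Real.Gamma (α i + k + 1))
  simp only [Finset.prod_const_one, inv_one, mul_one] at hlim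
  refine hlim.congr' ?_
  filter_upwards [eventually_gt_atTop 0, eventually_gt_atTop (-α i)] with β hβ hβα
  have hx : 0 < α i + β := by linarith
  rw [coeff_jpI, if_pos hl, coeff_lagI_of_lt α m i hl, betaMoment]
  have g1 : Real.Gamma (α i + β + len m) = Real.Gamma (α i + β) * poch (α i + β) (len m) :=
    Gamma_add_nat hx _
  have g2 : Real.Gamma (α i + k + 1 + (β + 1))
      = Real.Gamma (α i + β) * poch (α i + β) (k + 2) := by
    rw [← Gamma_add_nat hx]; push_cast; ring_nf
  have g3 : Real.Gamma (β + len m) = Real.Gamma (β + 1) * poch (1 + β) M := by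
    rw [add_comm 1 β, ← Gamma_add_nat (by linarith), hM]; push_cast; ring_nf
  have e1 : ∀ q, α q + β + (len m : ℝ) = α q + len m + β := fun q => by ring
  rw [g1, g2, g3]
  simp_rw [e1, Finset.prod_div_distrib, Finset.prod_pow_eq_pow_sum]
  rw [← len]
  have n1 : Real.Gamma (α i + β) ≠ 0 := (Real.Gamma_pos_of_pos hx).ne'
  have n2 : Real.Gamma (β + 1) ≠ 0 := (Real.Gamma_pos_of_pos (by linarith)).ne'
  have n3 : β ≠ 0 := hβ.ne'
  set A := ∏ q ∈ Finset.univ.erase i, poch (α q - α i) (m q)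
  set B := ∏ q, poch (α q + len m + β) (m q)
  have pw : (β ^ (k + 1) / β ^ (len m + l)) = (β ^ len m)⁻¹ * (β ^ l)⁻¹ * (β ^ len m)⁻¹
      * (β ^ (k + 2)) * β ^ M := by
    rw [hM]; field_simp; ring
  rw [pw]
  have c1 : Real.Gamma (α i + β) * (Real.Gamma (α i + β))⁻¹ = 1 := mul_inv_cancel₀ n1
  have c2 : Real.Gamma (β + 1) * (Real.Gamma (β + 1))⁻¹ = 1 := mul_inv_cancel₀ n2
  set G := Real.Gamma (α i + β)
  set H := Real.Gamma (β + 1)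
  -- The other side carries these Gamma factors uncancelled; padding makes the two sides formally
  -- equal.
  have pad : ∀ x : ℝ, x = x * (G * G⁻¹) * (H * H⁻¹) := fun x => by rw [c1, c2, mul_one, mul_one]
  refine (pad _).trans ?_
  simp only [div_eq_mul_inv, mul_inv, inv_inv, one_mul]
  ring

lemma integrableOn_pow_mul_beta {a β : ℝ} (ha : -1 < a) (hβ : 0 < β) (k : ℕ) :
    IntegrableOn (fun x : ℝ => x ^ k * (x ^ a * (1 - x) ^ β)) (Set.Icc 0 1) ∧
    ∫ x in Set.Icc (0 : ℝ) 1, x ^ k * (x ^ a * (1 - x) ^ β) = betaMoment a β k := by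
  have hk : (0 : ℝ) ≤ k := k.cast_nonneg
  have h1 : 0 < a + k + 1 := by linarith
  have h2 : 0 < β + 1 := by linarith
  have e : Set.EqOn (fun x : ℝ => (((x ^ k * (x ^ a * (1 - x) ^ β) : ℝ)) : ℂ))
      (fun x : ℝ => (x : ℂ) ^ (((a + k + 1 : ℝ) : ℂ) - 1) * (1 - (x : ℂ)) ^ (((β + 1 : ℝ) : ℂ) - 1))
      (Set.Ioc 0 1) := by
    rintro x ⟨hx0, hx1⟩
    have : x ^ k * (x ^ a * (1 - x) ^ β)
        = x ^ (a + k + 1 - 1) * (1 - x) ^ (β + 1 - 1) := by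
      rw [add_sub_cancel_right, add_sub_cancel_right, Real.rpow_add hx0, Real.rpow_natCast]
      ring
    simp only
    rw [this, Complex.ofReal_mul, Complex.ofReal_cpow hx0.le, Complex.ofReal_cpow (by linarith)]
    push_cast
    rfl
  have hc := Complex.betaIntegral_convergent (u := ((a + k + 1 : ℝ) : ℂ))
    (v := ((β + 1 : ℝ) : ℂ)) (by simpa using h1) (by simpa using h2)
  rw [intervalIntegrable_iff_integrableOn_Ioc_of_le zero_le_one,
    ← integrableOn_congr_fun e measurableSet_Ioc] at hc
  rw [integrableOn_Icc_iff_integrableOn_Ioc, integral_Icc_eq_integral_Ioc]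
  refine ⟨?_, ?_⟩
  · have := Integrable.re hc
    simp only [RCLike.re_to_complex, Complex.ofReal_re] at this
    exact this
  · have h := ProbabilityTheory.beta_eq_betaIntegralReal (a + k + 1) (β + 1) h1 h2
    rw [betaMoment, ← ProbabilityTheory.beta, h, Complex.betaIntegral,
      intervalIntegral.integral_of_le zero_le_one, ← setIntegral_congr_fun measurableSet_Ioc e,
      integral_complex_ofReal, Complex.ofReal_re]

lemma integral_jpII_mul_jpI {α : Fin p → ℝ} (hα : ∀ i, -1 < α i) {β : ℝ} (hβ : 0 < β)
    (n m : Fin p → ℕ) :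
    ∫ x in Set.Icc (0 : ℝ) 1, x * (jpII α β n).eval x
        * ∑ i, (jpI α β m i).eval x * jpWeight α β i x
      = ∑ i, ∑ l ∈ Fintype.piFinset (fun q => Finset.range (n q + 1)), ∑ r ∈ Finset.range (m i),
        jpCoeffII α β n l * ((jpI α β m i).coeff r * betaMoment (α i) β (1 + ∑ q, l q + r)) := by
  have e : ∀ x : ℝ, x * (jpII α β n).eval x * ∑ i, (jpI α β m i).eval x * jpWeight α β i x
      = ∑ i, ∑ l ∈ Fintype.piFinset (fun q => Finset.range (n q + 1)), ∑ r ∈ Finset.range (m i),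
        (jpCoeffII α β n l * (jpI α β m i).coeff r)
          * (x ^ (1 + ∑ q, l q + r) * (x ^ α i * (1 - x) ^ β)) := by
    intro x
    rw [Finset.mul_sum]
    refine Finset.sum_congr rfl fun i _ => ?_
    rw [jpII, eval_finsetSum, Finset.mul_sum, Finset.sum_mul]
    refine Finset.sum_congr rfl fun l _ => ?_
    nth_rw 1 [jpI_eq_sum]
    rw [eval_finsetSum, Finset.sum_mul, Finset.mul_sum]
    refine Finset.sum_congr rfl fun r _ => ?_
    simp only [eval_mul, eval_C, eval_pow, eval_X, jpWeight]
    ring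
  have hint : ∀ (i : Fin p) (l : Fin p → ℕ) (r : ℕ), IntegrableOn (fun x : ℝ =>
      (jpCoeffII α β n l * (jpI α β m i).coeff r)
          * (x ^ (1 + ∑ q, l q + r) * (x ^ α i * (1 - x) ^ β))) (Set.Icc 0 1) :=
    fun i l r => (integrableOn_pow_mul_beta (hα i) hβ _).1.const_mul _
  simp_rw [e]
  rw [integral_finsetSum _ fun i _ => integrable_finsetSum _ fun l _ =>
    integrable_finsetSum _ fun r _ => hint i l r]
  refine Finset.sum_congr rfl fun i _ => ?_
  rw [integral_finsetSum _ fun l _ => integrable_finsetSum _ fun r _ => hint i l r]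
  refine Finset.sum_congr rfl fun l _ => ?_
  rw [integral_finsetSum _ fun r _ => hint i l r]
  refine Finset.sum_congr rfl fun r _ => ?_
  rw [integral_const_mul, (integrableOn_pow_mul_beta (hα i) hβ _).2, mul_assoc]

/-- The same triple sum as in `integral_jpII_mul_jpI`, so that limits can be taken term by term. -/
lemma pairing_X_mul_lagII {α : Fin p → ℝ} (hα : ∀ i, -1 < α i)
    (hdiff : ∀ i j, i ≠ j → ∀ z : ℤ, α i - α j ≠ z) (n m : Fin p → ℕ) :
    pairing α m (X * lagII α n)
      = ∑ i, ∑ l ∈ Fintype.piFinset (fun q => Finset.range (n q + 1)), ∑ r ∈ Finset.range (m i),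
        lagCoeffII α n l * ((lagI α m i).coeff r
          * Real.Gamma (α i + (1 + ∑ q, l q + r : ℕ) + 1)) := by
  rw [pairing, nodes, Finset.sum_sigma, ← nodes]
  refine Finset.sum_congr rfl fun i _ => ?_
  rw [Finset.sum_comm]
  refine Finset.sum_congr rfl fun r hr => ?_
  rw [lagII, Finset.mul_sum, map_sum, eval_finsetSum, Finset.mul_sum]
  refine Finset.sum_congr rfl fun l _ => ?_
  have hi := hα i
  have hr0 : (0 : ℝ) ≤ r := r.cast_nonneg
  have hpos : 0 < α i + r + 1 := by linarith
  have g := (Real.Gamma_pos_of_pos hpos).ne'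
  rw [show X * (C (lagCoeffII α n l) * X ^ (∑ q, l q))
      = C (lagCoeffII α n l) * X ^ (1 + ∑ q, l q) by ring, mellin_eval_C_mul_X_pow,
    coeff_lagI hα hdiff, residue, if_pos (Finset.mem_range.mp hr),
    show α i + (1 + ∑ q, l q + r : ℕ) + 1 = α i + r + 1 + (1 + ∑ q, l q : ℕ) by push_cast; ring,
    Gamma_add_nat hpos]
  simp only [node]
  field_simp

/-- The scalings of the two factors combine to `β^{|n|+2-|m|}`, in which the summation indices have
cancelled. The exponent is `1` for `m = n + e_k` and `j + 1` for `m = n - s_{j-1}`. -/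
lemma tendsto_integral_jpII_mul_jpI {α : Fin p → ℝ} (hα : ∀ i, -1 < α i)
    (hdiff : ∀ i j, i ≠ j → ∀ z : ℤ, α i - α j ≠ z) (n m : Fin p → ℕ) :
    Tendsto (fun β : ℝ => (β ^ (len n + 2) / β ^ len m) * ∫ x in Set.Icc (0 : ℝ) 1,
      x * (jpII α β n).eval x * ∑ i, (jpI α β m i).eval x * jpWeight α β i x) atTop
      (𝓝 (pairing α m (X * lagII α n))) := by
  rw [pairing_X_mul_lagII hα hdiff]
  have h : Tendsto (fun β : ℝ => ∑ i, ∑ l ∈ Fintype.piFinset (fun q => Finset.range (n q + 1)),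
      ∑ r ∈ Finset.range (m i), (jpCoeffII α β n l * (β ^ len n / β ^ (∑ q, l q)))
        * ((jpI α β m i).coeff r * betaMoment (α i) β (1 + ∑ q, l q + r)
          * (β ^ ((1 + ∑ q, l q + r) + 1) / β ^ (len m + r)))) atTop
      (𝓝 (∑ i, ∑ l ∈ Fintype.piFinset (fun q => Finset.range (n q + 1)), ∑ r ∈ Finset.range (m i),
        lagCoeffII α n l * ((lagI α m i).coeff r
          * Real.Gamma (α i + (1 + ∑ q, l q + r : ℕ) + 1)))) :=
    tendsto_finsetSum _ fun i _ => tendsto_finsetSum _ fun l _ => tendsto_finsetSum _ fun r hr =>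
      (tendsto_jpCoeffII α n l).mul
        (tendsto_coeff_jpI_mul_betaMoment α m i (Finset.mem_range.mp hr) _)
  refine h.congr' ?_
  filter_upwards [eventually_gt_atTop 0] with β hβ
  rw [integral_jpII_mul_jpI hα hβ, Finset.mul_sum]
  simp_rw [Finset.mul_sum]
  refine Finset.sum_congr rfl fun i _ => Finset.sum_congr rfl fun l _ =>
    Finset.sum_congr rfl fun r _ => ?_
  have : β ^ (len n + 2) / β ^ len m = (β ^ len n / β ^ (∑ q, l q))
      * (β ^ ((1 + ∑ q, l q + r) + 1) / β ^ (len m + r)) := by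
    field_simp
    ring
  rw [this]
  ring

lemma tendsto_jpB0 {α : Fin p → ℝ} (hα : ∀ i, -1 < α i)
    (hdiff : ∀ i j, i ≠ j → ∀ z : ℤ, α i - α j ≠ z) (n : Fin p → ℕ) (k : Fin p) :
    Tendsto (fun β : ℝ => β * jpB0 α β n k) atTop (𝓝 (lagB0 α n k)) := by
  have h := tendsto_integral_jpII_mul_jpI hα hdiff n (n + Pi.single k 1)
  rw [pairing_X_mul_add_single hα hdiff] at h
  refine h.congr' ?_
  filter_upwards [eventually_gt_atTop 0] with β hβ
  rw [jpB0, len_add_single]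
  congr 1
  field_simp
  ring

lemma tendsto_jpB {α : Fin p → ℝ} (hα : ∀ i, -1 < α i)
    (hdiff : ∀ i j, i ≠ j → ∀ z : ℤ, α i - α j ≠ z) (π : Equiv.Perm (Fin p)) (n : Fin p → ℕ)
    {j : ℕ} (hj1 : 1 ≤ j) (hjp : j ≤ p) (hn : shift π (j - 1) ≤ n) :
    Tendsto (fun β : ℝ => β ^ (j + 1) * jpB α β π n j) atTop (𝓝 (lagB α π n j)) := by
  obtain ⟨m, rfl⟩ : ∃ m, n = m + shift π (j - 1) :=
    ⟨n - shift π (j - 1), (tsub_add_cancel_of_le hn).symm⟩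
  have h := tendsto_integral_jpII_mul_jpI hα hdiff (m + shift π (j - 1)) m
  rw [pairing_X_mul_of_add_shift hα hdiff, Nat.sub_add_cancel hj1] at h
  refine h.congr' ?_
  filter_upwards [eventually_gt_atTop 0] with β hβ
  rw [jpB, add_tsub_cancel_right, len_add, len_shift π (by omega)]
  congr 1
  rw [div_eq_iff (by positivity), ← pow_add]
  congr 1
  omega

end MultLaguerre

end

theorem mainTheorem2 {p : ℕ} (α : Fin p → ℝ) (hα : ∀ i, -1 < α i)
    (hdiff : ∀ i j, i ≠ j → ∀ z : ℤ, α i - α j ≠ z) :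
    -- the explicit polynomials are the type II and type I multiple orthogonal polynomials
    (∀ n : Fin p → ℕ,
      MultLaguerre.IsTypeII (Set.Ici 0) (MultLaguerre.lagWeight α) n (MultLaguerre.lagII α n) ∧
      MultLaguerre.IsTypeI (Set.Ici 0) (MultLaguerre.lagWeight α) n (MultLaguerre.lagI α n)) ∧
    -- type II nearest-neighbour recurrence: whenever the zero entries of `n` come last along `π`
    -- (in particular whenever all entries of `n` are positive)
    (∀ (π : Equiv.Perm (Fin p)) (n : Fin p → ℕ) (k : Fin p),
      (∀ i j : Fin p, i ≤ j → n (π i) = 0 → n (π j) = 0) →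
      MultLaguerre.TypeIIRecurrence (MultLaguerre.lagII α) (MultLaguerre.lagB0 α)
        (MultLaguerre.lagB α) π n k) ∧
    -- type I nearest-neighbour recurrence
    (∀ (π : Equiv.Perm (Fin p)) (n : Fin p → ℕ) (k : Fin p), 1 ≤ n k →
      MultLaguerre.TypeIRecurrence (MultLaguerre.lagI α) (MultLaguerre.lagB0 α)
        (MultLaguerre.lagB α) π n k) ∧
    -- the coefficients are scaled limits of the Jacobi–Piñeiro ones
    (∀ (n : Fin p → ℕ) (k : Fin p),
      Tendsto (fun β : ℝ => β * MultLaguerre.jpB0 α β n k) atTop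
        (𝓝 (MultLaguerre.lagB0 α n k))) ∧
    (∀ (π : Equiv.Perm (Fin p)) (n : Fin p → ℕ) (j : ℕ), 1 ≤ j → j ≤ p →
      MultLaguerre.shift π (j - 1) ≤ n →
      Tendsto (fun β : ℝ => β ^ (j + 1) * MultLaguerre.jpB α β π n j) atTop
        (𝓝 (MultLaguerre.lagB α π n j))) := by
  refine ⟨fun n => ⟨MultLaguerre.isTypeII_lagII α hα n, MultLaguerre.isTypeI_lagI hα hdiff n⟩,
    fun π n k hn => MultLaguerre.typeIIRecurrence_lagII hα hdiff π n k hn,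
    fun π n k hn => MultLaguerre.typeIRecurrence_lagI hα hdiff π n k hn,
    fun n k => MultLaguerre.tendsto_jpB0 hα hdiff n k,
    fun π n j hj1 hjp hn => MultLaguerre.tendsto_jpB hα hdiff π n hj1 hjp hn⟩
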